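/- For $T\in M_n(\mathbb C)$ let $|T|=(T^*T)^{1/2}$, let $\sigma(\cdot)$ denote the spectrum, and for $b>0$ put $M_n[0,b]=\{X\in M_n(\mathbb C):\sigma(|X|)\subset[0,b]\}$. Let $\varphi_1,\varphi_2:[0,b]\to\mathbb R$ be increasing (in the weak sense), Lipschitz and of class $C^1$ on $[0,b]$, with $\varphi_1+\varphi_2$ strictly increasing, $\varphi_1'(x)+\varphi_2'(x)>0$ for all $x\in(0,b]$, and $\varphi_1(0)=\varphi_2(0)=0$. For $X\in M_n[0,b]$ put $\varphi(X)=\varphi_1(|X|)-\varphi_2(|X^*|)$. For $r,\varepsilon>0$ put $$R_{r,\varepsilon}=\{z\in\mathbb C:\ 0\le \operatorname{Re}z\le r+\varepsilon,\ -\varepsilon\le\operatorname{Im}z\le\varepsilon\}.$$ **Theorem.** Assume that for some $\varepsilon>0$ and $i=1,2$ the function $x\mapsto\varphi_i(\sqrt x)$ on $[0,b^2]$ extends to a continuous function $\psi_i$ on $R_{b^2,\varepsilon}$ that is holomorphic in the interior of $R_{b^2,\varepsilon}$. Assume moreover that one of the following two conditions holds: 1. $\displaystyle\int_{-\varepsilon}^{\varepsilon}\frac{|\psi_i(it)|}{t^2}\,dt<\infty$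 for $i=1,2$; 2. $\varphi_2=0$ on $[0,b]$, the function $\varphi_1'(x)/x$ is bounded on $(0,b]$, and $\displaystyle\int_{-\varepsilon}^{\varepsilon}\frac{|\psi_1(it)|}{|t|}\,dt<\infty$. Then for every $T\in M_n[0,b]$ the initial value problem $$\frac{dX(t)}{dt}=[\varphi(X(t)),X(t)]=\varphi(X(t))X(t)-X(t)\varphi(X(t)),\qquad X(0)=T,$$ has a unique solution $X:[0,\infty)\to M_n[0,b]$ (so that the flow $F^\varphi_t(T)=X(t)$ is well defined), and $X(t)$ converges to a normal matrix as $t\to\infty$. -/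

import Mathlib

open Matrix Set Filter Topology MeasureTheory
open scoped ComplexOrder

/-- `(C0)`: `φ₁, φ₂` are continuous and increasing on `[a, b]`, and `φ₁ + φ₂` is strictly
increasing there. Only the values on `[a, b]` matter. -/
structure CondC0 (φ₁ φ₂ : ℝ → ℝ) (a b : ℝ) : Prop where
  continuousOn₁ : ContinuousOn φ₁ (Icc a b)
  continuousOn₂ : ContinuousOn φ₂ (Icc a b)
  monotoneOn₁ : MonotoneOn φ₁ (Icc a b)
  monotoneOn₂ : MonotoneOn φ₂ (Icc a b)
  strictMonoOn_add : StrictMonoOn (fun x => φ₁ x + φ₂ x) (Icc a b)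

/-- `(CL)`: in addition to `(C0)`, both functions are Lipschitz on `[a, b]`. -/
structure CondCL (φ₁ φ₂ : ℝ → ℝ) (a b : ℝ) : Prop extends CondC0 φ₁ φ₂ a b where
  lipschitz₁ : ∃ K, LipschitzOnWith K φ₁ (Icc a b)
  lipschitz₂ : ∃ K, LipschitzOnWith K φ₂ (Icc a b)

/-- `(C1)`: in addition to `(CL)`, both functions are `C¹` on `[a, b]` (one-sided derivatives at
the end points), and `φ₁' + φ₂' > 0` on `[a, b] \ {0}`. -/
structure CondC1 (φ₁ φ₂ : ℝ → ℝ) (a b : ℝ) : Prop extends CondCL φ₁ φ₂ a b where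
  contDiffOn₁ : ContDiffOn ℝ 1 φ₁ (Icc a b)
  contDiffOn₂ : ContDiffOn ℝ 1 φ₂ (Icc a b)
  deriv_pos : ∀ x ∈ Icc a b \ {0},
    0 < derivWithin φ₁ (Icc a b) x + derivWithin φ₂ (Icc a b) x

/-- The absolute value `|X| = (X^* X)^{1/2}` of a complex matrix, through the continuous
functional calculus of the Hermitian matrix `X^* X`. -/
noncomputable def matAbs {n : ℕ} (X : Matrix (Fin n) (Fin n) ℂ) : Matrix (Fin n) (Fin n) ℂ :=
  cfc Real.sqrt (Xᴴ * X)

theorem matAbs_isHermitian {n : ℕ} (X : Matrix (Fin n) (Fin n) ℂ) : (matAbs X).IsHermitian :=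
  cfc_predicate Real.sqrt (Xᴴ * X)

theorem matAbs_mul_self {n : ℕ} (X : Matrix (Fin n) (Fin n) ℂ) :
    matAbs X * matAbs X = Xᴴ * X := by
  have hsa : IsSelfAdjoint (Xᴴ * X) := Matrix.isHermitian_conjTranspose_mul_self X
  unfold matAbs
  rw [← cfc_mul Real.sqrt Real.sqrt (Xᴴ * X) (by fun_prop) (by fun_prop)]
  conv_rhs => rw [← cfc_id ℝ (Xᴴ * X)]
  refine cfc_congr fun x hx => Real.mul_self_sqrt ?_
  have h := (Matrix.posSemidef_iff_isHermitian_and_spectrum_nonneg.1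
    (Matrix.posSemidef_conjTranspose_mul_self X)).2 (spectrum.algebraMap_mem ℂ hx)
  simpa using h

theorem matAbs_posSemidef {n : ℕ} (X : Matrix (Fin n) (Fin n) ℂ) : (matAbs X).PosSemidef := by
  have hsa : IsSelfAdjoint (Xᴴ * X) := Matrix.isHermitian_conjTranspose_mul_self X
  rw [(matAbs_isHermitian X).posSemidef_iff_eigenvalues_nonneg]
  intro i
  have h := (matAbs_isHermitian X).eigenvalues_mem_spectrum_real i
  have h2 : spectrum ℝ (matAbs X) = Real.sqrt '' spectrum ℝ (Xᴴ * X) :=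
    cfc_map_spectrum (R := ℝ) Real.sqrt (Xᴴ * X)
  rw [h2] at h
  obtain ⟨x, -, hx⟩ := h
  rw [← hx]
  exact Real.sqrt_nonneg x

/-- The set `M_n[a, b]` of the `n × n` complex matrices `X` with `σ(|X|) ⊆ [a, b]`. -/
def matIcc (n : ℕ) (a b : ℝ) : Set (Matrix (Fin n) (Fin n) ℂ) :=
  {X | spectrum ℝ (matAbs X) ⊆ Icc a b}

/-- `φ(X) = φ₁(|X|) - φ₂(|X^*|)`. -/
noncomputable def phiMat {n : ℕ} (φ₁ φ₂ : ℝ → ℝ) (X : Matrix (Fin n) (Fin n) ℂ) :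
    Matrix (Fin n) (Fin n) ℂ :=
  cfc φ₁ (matAbs X) - cfc φ₂ (matAbs Xᴴ)

/-- `X` solves `dX/dt = [φ(X), X]`, `X(0) = T` on `[0, ∞)`, with values in `M_n[a, b]`, the domain
of `φ`. The values `X t` for `t < 0` play no role. -/
structure IsGlobalSolution {n : ℕ} (φ₁ φ₂ : ℝ → ℝ) (a b : ℝ) (T : Matrix (Fin n) (Fin n) ℂ)
    (X : ℝ → Matrix (Fin n) (Fin n) ℂ) : Prop where
  init : X 0 = T
  mem : ∀ t, 0 ≤ t → X t ∈ matIcc n a b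
  ode : ∀ t, 0 ≤ t →
    HasDerivWithinAt X (phiMat φ₁ φ₂ (X t) * X t - X t * phiMat φ₁ φ₂ (X t)) (Ici 0) t

/-- The closed rectangle `R_{r, ε} = {z | 0 ≤ Re z ≤ r + ε, -ε ≤ Im z ≤ ε}`. -/
def rect (r ε : ℝ) : Set ℂ :=
  {z | 0 ≤ z.re ∧ z.re ≤ r + ε ∧ -ε ≤ z.im ∧ z.im ≤ ε}

/-- `ψ` extends `x ↦ φ(√x)`, `x ∈ [0, b²]`, to a continuous function on `R_{b², ε}` that is
holomorphic in the interior. -/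
structure IsHolomorphicExtension (φ : ℝ → ℝ) (b ε : ℝ) (ψ : ℂ → ℂ) : Prop where
  eq_on : ∀ x ∈ Icc 0 (b ^ 2), ψ (x : ℂ) = (φ (Real.sqrt x) : ℂ)
  continuousOn : ContinuousOn ψ (rect (b ^ 2) ε)
  holomorphic : DifferentiableOn ℂ ψ (interior (rect (b ^ 2) ε))

/-! Well-posedness. A Lipschitz function of `|X|` is Lipschitz in `X` for the Frobenius norm
(`norm_cfc_matAbs_sub_le`). Once the `φᵢ` are extended constantly beyond `b` and `X` is cut off
radially, the field is therefore bounded and globally Lipschitz, and its integral curves are global.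
The matrices `XᴴX` and `XXᴴ` have the same eigenvalues, in bases whose squared overlaps form a
doubly stochastic matrix. Birkhoff's theorem and the rearrangement inequality then give `Re tr (φ(X)
((XᴴX)^k - (XXᴴ)^k)) ≥ 0`, so every `tr (XᴴX)^k` decreases. These bounds for all `k` confine the
singular values to `[0, b]`, where the truncations are invisible.

Limit points. The case `k = 1` is the dissipation of `‖X‖²`. It vanishes only at normal matrices
(`isStarNormal_of_re_trace_eq_zero`), so LaSalle's principle makes all limit points normal.

Convergence. The equation has Lax form, so each polynomial `q(X)` satisfies the same commutator
equation and polynomial relations persist. Let `P = q(X)` be an idempotent and `E = P - Pᴴ`. Then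
`[φ(X), P]` is controlled by `E`, and the derivative of `‖E‖²` is a quadratic form in `E`. At a
normal `N` this form is minus a sum of squared entries of `[Nᴴ, E]` with nonnegative weights, and it
vanishes only if `E` commutes with `N` (`IsSVD.commute_of_commForm_nonneg`). In the limit `E` is
off-diagonal for `P`, which excludes commuting unless `E = 0`. Compactness turns this into a uniform
rate, so `E` decays exponentially, the derivative of `P` is integrable and `P` converges. Finally,
`X` minus the combination `∑ z P_z` of its spectral idempotents is nilpotent. At a normal limit
point this nilpotent vanishes, so every limit point equals `∑ z lim P_z`. -/

section SpectralFlow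

open scoped Matrix.Norms.Frobenius

variable {n : ℕ}

/-! ### Singular value decompositions and functional calculus -/

/-- The real diagonal matrix with complex entries. -/
noncomputable abbrev rdiag (α : Fin n → ℝ) : Matrix (Fin n) (Fin n) ℂ :=
  diagonal fun i => (α i : ℂ)

/-- `X = V * diag α * Uᴴ` is a singular value decomposition of `X`. -/
structure IsSVD (X V U : Matrix (Fin n) (Fin n) ℂ) (α : Fin n → ℝ) : Prop where
  left : Vᴴ * V = 1
  right : Uᴴ * U = 1
  nonneg : ∀ i, 0 ≤ α i
  eq : X = V * rdiag α * Uᴴ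

theorem rdiag_conjTranspose (α : Fin n → ℝ) : (rdiag α)ᴴ = rdiag α := by
  rw [rdiag, diagonal_conjTranspose]
  congr 1
  ext i
  simp

theorem rdiag_mul_rdiag (α β : Fin n → ℝ) : rdiag α * rdiag β = rdiag fun i => α i * β i := by
  simp [rdiag, diagonal_mul_diagonal]

theorem IsSVD.conjTranspose {X V U : Matrix (Fin n) (Fin n) ℂ} {α : Fin n → ℝ}
    (h : IsSVD X V U α) : IsSVD Xᴴ U V α where
  left := h.right
  right := h.left
  nonneg := h.nonneg
  eq := by
    rw [h.eq, conjTranspose_mul, conjTranspose_mul, conjTranspose_conjTranspose,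
      rdiag_conjTranspose, mul_assoc]

theorem IsSVD.conjTranspose_mul_self {X V U : Matrix (Fin n) (Fin n) ℂ} {α : Fin n → ℝ}
    (h : IsSVD X V U α) : Xᴴ * X = U * rdiag (fun i => α i ^ 2) * Uᴴ := by
  have : Xᴴ * X = U * (rdiag α * (Vᴴ * V) * rdiag α) * Uᴴ := by
    conv_lhs => rw [h.conjTranspose.eq, h.eq]
    simp only [mul_assoc]
  rw [this, h.left, mul_one, rdiag_mul_rdiag]
  simp only [sq]

theorem col_eq_zero_of_gram_eq_zero {M : Matrix (Fin n) (Fin n) ℂ} {d : Fin n}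
    (h : (Mᴴ * M) d d = 0) (i : Fin n) : M i d = 0 :=
  congrFun (dotProduct_star_self_eq_zero (v := fun i => M i d) |>.1 h) i

/-- Diagonalise `XᴴX` by `U`. The columns of `XU` are orthogonal with the eigenvalues as squared
norms, so the nonzero ones normalise to part of an orthonormal basis. -/
theorem exists_isSVD (X : Matrix (Fin n) (Fin n) ℂ) :
    ∃ V U α, IsSVD X V U α := by
  have hH : (Xᴴ * X).IsHermitian := isHermitian_conjTranspose_mul_self X
  set U : Matrix (Fin n) (Fin n) ℂ := hH.eigenvectorUnitary.1 with hU
  have hUU : Uᴴ * U = 1 := Unitary.coe_star_mul_self hH.eigenvectorUnitary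
  have hUU' : U * Uᴴ = 1 := Unitary.coe_mul_star_self hH.eigenvectorUnitary
  have hspec : Xᴴ * X = U * rdiag hH.eigenvalues * Uᴴ := by
    have := hH.spectral_theorem
    rw [Unitary.conjStarAlgAut_apply] at this
    exact this
  have hnn : ∀ i, 0 ≤ hH.eigenvalues i := (posSemidef_conjTranspose_mul_self X).eigenvalues_nonneg
  set α : Fin n → ℝ := fun i => √(hH.eigenvalues i) with hα
  have hsq : ∀ i, α i * α i = hH.eigenvalues i := fun i => Real.mul_self_sqrt (hnn i)
  set M := X * U with hM
  have hMM : Mᴴ * M = rdiag hH.eigenvalues := by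
    calc Mᴴ * M = Uᴴ * (Xᴴ * X) * U := by rw [hM, conjTranspose_mul]; simp only [mul_assoc]
      _ = Uᴴ * (U * rdiag hH.eigenvalues * Uᴴ) * U := congrArg (fun Z => Uᴴ * Z * U) hspec
      _ = (Uᴴ * U) * rdiag hH.eigenvalues * (Uᴴ * U) := by simp only [mul_assoc]
      _ = _ := by rw [hUU, one_mul, mul_one]
  have hMent : ∀ a b, ∑ i, star (M i a) * M i b = if a = b then (hH.eigenvalues a : ℂ) else 0 := by
    intro a b
    have := congrFun (congrFun hMM a) b
    rw [mul_apply] at this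
    simpa [diagonal_apply] using this
  let v : Fin n → EuclideanSpace ℂ (Fin n) :=
    fun a => WithLp.toLp 2 fun i => ((α a : ℂ))⁻¹ * M i a
  let s : Set (Fin n) := {a | α a ≠ 0}
  have hv : Orthonormal ℂ (s.domRestrict v) := by
    rw [orthonormal_iff_ite]
    rintro ⟨a, ha⟩ ⟨b, hb⟩
    have ha' : (α a : ℂ) ≠ 0 := by exact_mod_cast ha
    have hb' : (α b : ℂ) ≠ 0 := by exact_mod_cast hb
    have h1 : inner ℂ (v a) (v b) = (α a : ℂ)⁻¹ * (α b : ℂ)⁻¹ * ∑ i, star (M i a) * M i b := by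
      simp only [v, PiLp.inner_apply, RCLike.inner_apply, Finset.mul_sum]
      refine Finset.sum_congr rfl fun i _ => ?_
      simp
      ring
    change inner ℂ (v a) (v b) = _
    rw [h1, hMent]
    by_cases hab : a = b
    · subst hab
      simp only [if_true]
      rw [← hsq a]
      push_cast
      field_simp
    · simp [hab]
  -- The columns of `V` at zero singular values are arbitrary; the corresponding columns of `M`
  -- vanish because their Gram entry does.
  obtain ⟨e, he⟩ := hv.exists_orthonormalBasis_extension_of_card_eq (by simp)
  let V : Matrix (Fin n) (Fin n) ℂ := fun i a => e a i
  have hVV : Vᴴ * V = 1 := by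
    ext a b
    have := orthonormal_iff_ite.1 e.orthonormal a b
    simp only [PiLp.inner_apply, RCLike.inner_apply] at this
    rw [mul_apply, one_apply, ← this]
    exact Finset.sum_congr rfl fun i _ => mul_comm (star (e a i)) (e b i)
  have hMV : M = V * rdiag α := by
    ext i a
    rw [mul_diagonal]
    by_cases ha : α a = 0
    · have h0 : (Mᴴ * M) a a = 0 := by
        rw [hMM]
        simp [rdiag, ← hsq a, ha]
      simp [ha, col_eq_zero_of_gram_eq_zero h0 i]
    · have ha' : (α a : ℂ) ≠ 0 := by exact_mod_cast ha
      have : V i a = (α a : ℂ)⁻¹ * M i a := by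
        simp only [V]
        rw [he a ha]
      rw [this]
      field_simp
  refine ⟨V, U, α, hVV, hUU, fun i => Real.sqrt_nonneg _, ?_⟩
  rw [← hMV, hM, mul_assoc, hUU', mul_one]

theorem aeval_unitary_conj_rdiag {U : Matrix (Fin n) (Fin n) ℂ} (hU : Uᴴ * U = 1)
    (α : Fin n → ℝ) (q : Polynomial ℝ) :
    Polynomial.aeval (U * rdiag α * Uᴴ) q = U * rdiag (fun i => q.eval (α i)) * Uᴴ := by
  have hU' : U * Uᴴ = 1 := mul_eq_one_comm.1 hU
  have hc : ∀ x : ℝ, algebraMap ℝ (Matrix (Fin n) (Fin n) ℂ) x = rdiag fun _ => x := fun x => by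
    ext i j
    simp [algebraMap_matrix_apply, diagonal_apply]
  induction q using Polynomial.induction_on' with
  | add p q hp hq =>
    rw [map_add, hp, hq, ← add_mul, ← mul_add]
    congr 2
    simp [rdiag, diagonal_add]
  | monomial k x =>
    rw [Polynomial.aeval_monomial, hc]
    have hp : (U * rdiag α * Uᴴ) ^ k = U * rdiag (fun i => α i ^ k) * Uᴴ := by
      induction k with
      | zero => simp [rdiag, hU']
      | succ k ih =>
        calc (U * rdiag α * Uᴴ) ^ (k + 1)
            = U * rdiag (fun i => α i ^ k) * (Uᴴ * U) * rdiag α * Uᴴ := by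
              rw [pow_succ, ih]; simp only [mul_assoc]
          _ = _ := by
              rw [hU, mul_one, mul_assoc U, rdiag_mul_rdiag]
              simp only [pow_succ]
    have hcomm : rdiag (fun _ => x) * U = U * rdiag (fun _ => x) := by
      ext i j
      simp [mul_comm]
    rw [hp, ← mul_assoc, ← mul_assoc, hcomm, mul_assoc U, rdiag_mul_rdiag]
    simp

theorem spectrum_unitary_conj_rdiag {U : Matrix (Fin n) (Fin n) ℂ} (hU : Uᴴ * U = 1)
    (α : Fin n → ℝ) : spectrum ℝ (U * rdiag α * Uᴴ) = range α := by
  have hU' : U * Uᴴ = 1 := mul_eq_one_comm.1 hU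
  let u : (Matrix (Fin n) (Fin n) ℂ)ˣ := ⟨U, Uᴴ, hU', hU⟩
  have h := spectrum.units_conjugate (R := ℝ) (a := rdiag α) (u := u)
  change spectrum ℝ (U * rdiag α * Uᴴ) = _ at h
  rw [h, ← spectrum.preimage_algebraMap ℂ, spectrum_diagonal]
  ext x
  simp

/-- The spectrum is finite, so `f` may be replaced by its Lagrange interpolant there; no continuity
of `f` is needed. -/
theorem cfc_unitary_conj_rdiag {U : Matrix (Fin n) (Fin n) ℂ} (hU : Uᴴ * U = 1)
    (α : Fin n → ℝ) (f : ℝ → ℝ) :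
    cfc f (U * rdiag α * Uᴴ) = U * rdiag (fun i => f (α i)) * Uᴴ := by
  classical
  have hsa : IsSelfAdjoint (U * rdiag α * Uᴴ) := by
    rw [IsSelfAdjoint, star_eq_conjTranspose, conjTranspose_mul, conjTranspose_mul,
      conjTranspose_conjTranspose, rdiag_conjTranspose, mul_assoc]
  let q : Polynomial ℝ := Lagrange.interpolate (Finset.univ.image α) id f
  have hq : ∀ i, q.eval (α i) = f (α i) := fun i =>
    Lagrange.eval_interpolate_at_node f (Function.injective_id.injOn)
      (Finset.mem_image_of_mem α (Finset.mem_univ i))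
  have h1 : cfc f (U * rdiag α * Uᴴ) = cfc q.eval (U * rdiag α * Uᴴ) := by
    refine cfc_congr ?_
    rw [spectrum_unitary_conj_rdiag hU]
    rintro _ ⟨i, rfl⟩
    exact (hq i).symm
  rw [h1, cfc_polynomial q _ hsa, aeval_unitary_conj_rdiag hU]
  simp only [hq]

theorem IsSVD.matAbs_eq {X V U : Matrix (Fin n) (Fin n) ℂ} {α : Fin n → ℝ}
    (h : IsSVD X V U α) : matAbs X = U * rdiag α * Uᴴ := by
  rw [matAbs, h.conjTranspose_mul_self, cfc_unitary_conj_rdiag h.right]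
  simp only [Real.sqrt_sq (h.nonneg _)]

theorem IsSVD.cfc_matAbs {X V U : Matrix (Fin n) (Fin n) ℂ} {α : Fin n → ℝ}
    (h : IsSVD X V U α) (f : ℝ → ℝ) :
    cfc f (matAbs X) = U * rdiag (fun i => f (α i)) * Uᴴ := by
  rw [h.matAbs_eq, cfc_unitary_conj_rdiag h.right]

theorem IsSVD.mem_matIcc_iff {X V U : Matrix (Fin n) (Fin n) ℂ} {α : Fin n → ℝ}
    (h : IsSVD X V U α) (a b : ℝ) : X ∈ matIcc n a b ↔ ∀ i, α i ∈ Icc a b := by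
  rw [matIcc, mem_ofPred_eq, h.matAbs_eq, spectrum_unitary_conj_rdiag h.right, range_subset_iff]

theorem IsSVD.phiMat_eq {X V U : Matrix (Fin n) (Fin n) ℂ} {α : Fin n → ℝ}
    (h : IsSVD X V U α) (φ₁ φ₂ : ℝ → ℝ) :
    phiMat φ₁ φ₂ X = U * rdiag (fun i => φ₁ (α i)) * Uᴴ - V * rdiag (fun i => φ₂ (α i)) * Vᴴ := by
  rw [phiMat, h.cfc_matAbs, h.conjTranspose.cfc_matAbs]

/-! ### Frobenius norm estimates and Lipschitz bounds for `φ(X)` -/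

theorem frobenius_norm_sq (A : Matrix (Fin n) (Fin n) ℂ) : ‖A‖ ^ 2 = ∑ i, ∑ j, ‖A i j‖ ^ 2 := by
  rw [frobenius_norm_def, ← Real.sqrt_eq_rpow, Real.sq_sqrt (by positivity)]
  simp

theorem trace_conjTranspose_mul_eq_sum (A B : Matrix (Fin n) (Fin n) ℂ) :
    trace (Aᴴ * B) = ∑ i, ∑ j, star (A i j) * B i j := by
  rw [Finset.sum_comm]
  simp [trace, mul_apply]

theorem frobenius_norm_sq_eq_trace (A : Matrix (Fin n) (Fin n) ℂ) :
    ‖A‖ ^ 2 = (trace (Aᴴ * A)).re := by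
  rw [frobenius_norm_sq, trace_conjTranspose_mul_eq_sum, Complex.re_sum]
  refine Finset.sum_congr rfl fun i _ => ?_
  rw [Complex.re_sum]
  refine Finset.sum_congr rfl fun j _ => ?_
  have := Complex.conj_mul' (A i j)
  simp only [RCLike.star_def, this]
  norm_cast

theorem frobenius_norm_unitary_mul {U : Matrix (Fin n) (Fin n) ℂ} (hU : Uᴴ * U = 1)
    (A : Matrix (Fin n) (Fin n) ℂ) : ‖U * A‖ = ‖A‖ := by
  refine (sq_eq_sq₀ (norm_nonneg _) (norm_nonneg _)).1 ?_
  rw [frobenius_norm_sq_eq_trace, frobenius_norm_sq_eq_trace, conjTranspose_mul, mul_assoc,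
    ← mul_assoc Uᴴ, hU, one_mul]

theorem frobenius_norm_mul_unitary {U : Matrix (Fin n) (Fin n) ℂ} (hU : Uᴴ * U = 1)
    (A : Matrix (Fin n) (Fin n) ℂ) : ‖A * U‖ = ‖A‖ := by
  rw [← frobenius_norm_conjTranspose, conjTranspose_mul, frobenius_norm_unitary_mul,
    frobenius_norm_conjTranspose]
  rw [conjTranspose_conjTranspose, mul_eq_one_comm.1 hU]

theorem conjTranspose_isometry {U : Matrix (Fin n) (Fin n) ℂ} (hU : Uᴴ * U = 1) :
    Uᴴᴴ * Uᴴ = 1 := by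
  rw [conjTranspose_conjTranspose, mul_eq_one_comm.1 hU]

theorem rdiag_mul_apply (α : Fin n → ℝ) (M : Matrix (Fin n) (Fin n) ℂ) (a b : Fin n) :
    (rdiag α * M) a b = α a * M a b := by
  simp [rdiag, diagonal_mul]

theorem mul_rdiag_apply (α : Fin n → ℝ) (M : Matrix (Fin n) (Fin n) ℂ) (a b : Fin n) :
    (M * rdiag α) a b = M a b * α b := by
  simp [rdiag, mul_diagonal]

/-- Frobenius distance of two matrices of the form `V * diag * Uᴴ` in mixed bases. -/
theorem norm_sub_sq_conj {V U V' U' : Matrix (Fin n) (Fin n) ℂ} (hV : Vᴴ * V = 1)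
    (hU' : U'ᴴ * U' = 1) (f g : Fin n → ℝ) :
    ‖V * rdiag f * Uᴴ - V' * rdiag g * U'ᴴ‖ ^ 2 =
      ∑ a, ∑ b, ‖f a * (Uᴴ * U') a b - (Vᴴ * V') a b * g b‖ ^ 2 := by
  rw [← frobenius_norm_unitary_mul (conjTranspose_isometry hV), ← frobenius_norm_mul_unitary hU']
  have : Vᴴ * (V * rdiag f * Uᴴ - V' * rdiag g * U'ᴴ) * U' =
      rdiag f * (Uᴴ * U') - (Vᴴ * V') * rdiag g := by
    calc _ = (Vᴴ * V) * rdiag f * (Uᴴ * U') - (Vᴴ * V') * rdiag g * (U'ᴴ * U') := by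
          simp only [mul_sub, sub_mul, mul_assoc]
      _ = _ := by rw [hV, hU', one_mul, mul_one]
  rw [this, frobenius_norm_sq]
  refine Finset.sum_congr rfl fun a _ => Finset.sum_congr rfl fun b _ => ?_
  rw [Matrix.sub_apply, rdiag_mul_apply, mul_rdiag_apply]

/-- The right side minus the left is `2xy‖p - q‖² + (x - y)²‖q‖²`. -/
theorem sq_sub_mul_norm_sq_le (x y : ℝ) (hx : 0 ≤ x) (hy : 0 ≤ y) (p q : ℂ) :
    (x - y) ^ 2 * ‖p‖ ^ 2 ≤ ‖x * p - q * y‖ ^ 2 + ‖x * q - p * y‖ ^ 2 := by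
  simp only [← Complex.normSq_eq_norm_sq, Complex.normSq_apply]
  simp
  nlinarith [mul_nonneg (mul_nonneg hx hy) (add_nonneg (sq_nonneg (p.re - q.re))
    (sq_nonneg (p.im - q.im))), mul_nonneg (sq_nonneg (x - y)) (add_nonneg (sq_nonneg q.re)
    (sq_nonneg q.im))]

/-- A Lipschitz function of the absolute value of a matrix is Lipschitz in the matrix, for the
Frobenius norm. -/
theorem norm_cfc_matAbs_sub_le {f : ℝ → ℝ} {L : ℝ} (hL : 0 ≤ L)
    (hf : ∀ x, 0 ≤ x → ∀ y, 0 ≤ y → |f x - f y| ≤ L * |x - y|)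
    (X Y : Matrix (Fin n) (Fin n) ℂ) :
    ‖cfc f (matAbs X) - cfc f (matAbs Y)‖ ≤ 2 * L * ‖X - Y‖ := by
  obtain ⟨V, U, α, h⟩ := exists_isSVD X
  obtain ⟨V', U', β, h'⟩ := exists_isSVD Y
  refine (sq_le_sq₀ (norm_nonneg _) (by positivity)).1 ?_
  rw [h.cfc_matAbs, h'.cfc_matAbs, norm_sub_sq_conj h.right h'.right]
  have h1 : ‖X - Y‖ ^ 2 =
      ∑ a, ∑ b, ‖α a * (Uᴴ * U') a b - (Vᴴ * V') a b * β b‖ ^ 2 := by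
    rw [h.eq, h'.eq, norm_sub_sq_conj h.left h'.right]
  -- Passing to adjoints exchanges the overlaps `UᴴU'` and `VᴴV'`. The entrywise inequality needs
  -- both versions, hence the factor 2 in the constant.
  have h2 : ‖X - Y‖ ^ 2 =
      ∑ a, ∑ b, ‖α a * (Vᴴ * V') a b - (Uᴴ * U') a b * β b‖ ^ 2 := by
    rw [← frobenius_norm_conjTranspose, conjTranspose_sub, h.conjTranspose.eq,
      h'.conjTranspose.eq, norm_sub_sq_conj h.right h'.left]
  have h3 : (2 * L * ‖X - Y‖) ^ 2 = 2 * L ^ 2 * (‖X - Y‖ ^ 2 + ‖X - Y‖ ^ 2) := by ring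
  rw [h3]
  nth_rewrite 1 [h1]
  rw [h2]
  simp only [← Finset.sum_add_distrib, Finset.mul_sum]
  refine Finset.sum_le_sum fun a _ => Finset.sum_le_sum fun b _ => ?_
  have e1 := sq_sub_mul_norm_sq_le (α a) (β b) (h.nonneg a) (h'.nonneg b) ((Uᴴ * U') a b)
    ((Vᴴ * V') a b)
  have e2 : ‖(f (α a) : ℂ) * (Uᴴ * U') a b - (Uᴴ * U') a b * f (β b)‖ ^ 2 =
      |f (α a) - f (β b)| ^ 2 * ‖(Uᴴ * U') a b‖ ^ 2 := by
    rw [mul_comm _ (f (β b) : ℂ), ← sub_mul, norm_mul, mul_pow]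
    norm_cast
  have e3 : |f (α a) - f (β b)| ^ 2 ≤ L ^ 2 * (α a - β b) ^ 2 := by
    rw [← sq_abs (α a - β b), ← mul_pow]
    exact pow_le_pow_left₀ (abs_nonneg _) (hf _ (h.nonneg a) _ (h'.nonneg b)) 2
  rw [e2]
  have e4 : 0 ≤ ‖(α a : ℂ) * (Uᴴ * U') a b - (Vᴴ * V') a b * β b‖ ^ 2 +
      ‖(α a : ℂ) * (Vᴴ * V') a b - (Uᴴ * U') a b * β b‖ ^ 2 := by positivity
  calc _ ≤ L ^ 2 * (α a - β b) ^ 2 * ‖(Uᴴ * U') a b‖ ^ 2 := by gcongr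
    _ ≤ L ^ 2 * (‖(α a : ℂ) * (Uᴴ * U') a b - (Vᴴ * V') a b * β b‖ ^ 2 +
      ‖(α a : ℂ) * (Vᴴ * V') a b - (Uᴴ * U') a b * β b‖ ^ 2) := by
        rw [mul_assoc]; gcongr
    _ ≤ _ := by nlinarith [sq_nonneg L, mul_nonneg (sq_nonneg L) e4]

theorem frobenius_norm_rdiag_le {f : Fin n → ℝ} {M : ℝ} (hf : ∀ i, |f i| ≤ M) :
    ‖rdiag f‖ ≤ n * M := by
  rcases Nat.eq_zero_or_pos n with rfl | hn
  · have : rdiag f = 0 := Subsingleton.elim _ _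
    simp [this]
  have hM : 0 ≤ M := (abs_nonneg _).trans (hf ⟨0, hn⟩)
  refine (sq_le_sq₀ (norm_nonneg _) (by positivity)).1 ?_
  rw [frobenius_norm_sq]
  calc ∑ i, ∑ j, ‖rdiag f i j‖ ^ 2 ≤ ∑ i : Fin n, ∑ j : Fin n, M ^ 2 := by
        refine Finset.sum_le_sum fun i _ => Finset.sum_le_sum fun j _ => ?_
        refine pow_le_pow_left₀ (norm_nonneg _) ?_ 2
        by_cases hij : i = j
        · subst hij
          simpa [rdiag] using hf i
        · simpa [rdiag, hij] using hM
    _ = _ := by simp; ring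

theorem norm_cfc_matAbs_le {f : ℝ → ℝ} {M : ℝ} {X : Matrix (Fin n) (Fin n) ℂ}
    (hf : ∀ x, 0 ≤ x → |f x| ≤ M) : ‖cfc f (matAbs X)‖ ≤ n * M := by
  obtain ⟨V, U, α, h⟩ := exists_isSVD X
  rw [h.cfc_matAbs, frobenius_norm_mul_unitary (conjTranspose_isometry h.right),
    frobenius_norm_unitary_mul h.right]
  exact frobenius_norm_rdiag_le fun i => hf _ (h.nonneg i)

theorem norm_phiMat_le {φ₁ φ₂ : ℝ → ℝ} {M : ℝ} (h₁ : ∀ x, 0 ≤ x → |φ₁ x| ≤ M)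
    (h₂ : ∀ x, 0 ≤ x → |φ₂ x| ≤ M) (X : Matrix (Fin n) (Fin n) ℂ) :
    ‖phiMat φ₁ φ₂ X‖ ≤ 2 * (n * M) := by
  rw [phiMat, two_mul]
  exact (norm_sub_le _ _).trans (add_le_add (norm_cfc_matAbs_le h₁) (norm_cfc_matAbs_le h₂))

theorem norm_phiMat_sub_le {φ₁ φ₂ : ℝ → ℝ} {L : ℝ} (hL : 0 ≤ L)
    (h₁ : ∀ x, 0 ≤ x → ∀ y, 0 ≤ y → |φ₁ x - φ₁ y| ≤ L * |x - y|)
    (h₂ : ∀ x, 0 ≤ x → ∀ y, 0 ≤ y → |φ₂ x - φ₂ y| ≤ L * |x - y|)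
    (X Y : Matrix (Fin n) (Fin n) ℂ) :
    ‖phiMat φ₁ φ₂ X - phiMat φ₁ φ₂ Y‖ ≤ 4 * L * ‖X - Y‖ := by
  have e1 := norm_cfc_matAbs_sub_le hL h₁ X Y
  have e2 := norm_cfc_matAbs_sub_le hL h₂ Xᴴ Yᴴ
  rw [← conjTranspose_sub, frobenius_norm_conjTranspose] at e2
  have e3 : phiMat φ₁ φ₂ X - phiMat φ₁ φ₂ Y =
      (cfc φ₁ (matAbs X) - cfc φ₁ (matAbs Y)) - (cfc φ₂ (matAbs Xᴴ) - cfc φ₂ (matAbs Yᴴ)) := by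
    simp only [phiMat]; abel
  rw [e3]
  refine (norm_sub_le _ _).trans ?_
  linarith

theorem IsSVD.norm_eq {X V U : Matrix (Fin n) (Fin n) ℂ} {α : Fin n → ℝ}
    (h : IsSVD X V U α) : ‖X‖ = ‖rdiag α‖ := by
  rw [h.eq, frobenius_norm_mul_unitary (conjTranspose_isometry h.right),
    frobenius_norm_unitary_mul h.left]

theorem norm_le_of_mem_matIcc {X : Matrix (Fin n) (Fin n) ℂ} {b : ℝ} (hX : X ∈ matIcc n 0 b) :
    ‖X‖ ≤ n * b := by
  obtain ⟨V, U, α, h⟩ := exists_isSVD X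
  rw [h.norm_eq]
  refine frobenius_norm_rdiag_le fun i => ?_
  have := (h.mem_matIcc_iff 0 b).1 hX i
  rw [abs_of_nonneg this.1]
  exact this.2

theorem phiMat_congr {φ₁ φ₂ φ₁' φ₂' : ℝ → ℝ} {X : Matrix (Fin n) (Fin n) ℂ} {a b : ℝ}
    (hX : X ∈ matIcc n a b) (h₁ : ∀ x ∈ Icc a b, φ₁ x = φ₁' x)
    (h₂ : ∀ x ∈ Icc a b, φ₂ x = φ₂' x) : phiMat φ₁ φ₂ X = phiMat φ₁' φ₂' X := by
  obtain ⟨V, U, α, h⟩ := exists_isSVD X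
  have hα := (h.mem_matIcc_iff a b).1 hX
  rw [h.phiMat_eq, h.phiMat_eq]
  simp only [h₁ _ (hα _), h₂ _ (hα _)]

/-! ### The trace inequality and its equality case -/

/-- The squared moduli of the entries of a unitary matrix form a doubly stochastic matrix. -/
theorem normSq_mem_doublyStochastic {W : Matrix (Fin n) (Fin n) ℂ} (hW : Wᴴ * W = 1) :
    (Matrix.of fun a b => ‖W a b‖ ^ 2) ∈ doublyStochastic ℝ (Fin n) := by
  rw [mem_doublyStochastic_iff_sum]
  have hW' : W * Wᴴ = 1 := mul_eq_one_comm.1 hW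
  refine ⟨fun i j => by simp only [of_apply]; positivity, fun i => ?_, fun j => ?_⟩
  · have := congrFun (congrFun hW' i) i
    rw [mul_apply, one_apply_eq] at this
    have h2 : ((∑ j, ‖W i j‖ ^ 2 : ℝ) : ℂ) = 1 := by
      rw [← this]
      push_cast
      refine Finset.sum_congr rfl fun j _ => ?_
      simpa using (Complex.mul_conj' (W i j)).symm
    exact_mod_cast h2
  · have := congrFun (congrFun hW j) j
    rw [mul_apply, one_apply_eq] at this
    have h2 : ((∑ i, ‖W i j‖ ^ 2 : ℝ) : ℂ) = 1 := by
      rw [← this]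
      push_cast
      refine Finset.sum_congr rfl fun i _ => ?_
      simpa using (Complex.conj_mul' (W i j)).symm
    exact_mod_cast h2

/-- The rearrangement inequality for doubly stochastic matrices. -/
theorem sum_doublyStochastic_le {f g : Fin n → ℝ} (hfg : Monovary f g)
    {w : Matrix (Fin n) (Fin n) ℝ} (hw : w ∈ doublyStochastic ℝ (Fin n)) :
    ∑ a, ∑ b, w a b * (f a * g b) ≤ ∑ a, f a * g a := by
  obtain ⟨c, hc, hc1, rfl⟩ := exists_eq_sum_perm_of_mem_doublyStochastic hw
  have h1 : ∀ σ : Equiv.Perm (Fin n),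
      ∑ a, ∑ b, (σ.permMatrix ℝ) a b * (f a * g b) ≤ ∑ a, f a * g a := fun σ => by
    have := hfg.sum_mul_comp_perm_le_sum_mul (σ := σ)
    refine le_trans (le_of_eq ?_) this
    refine Finset.sum_congr rfl fun a _ => ?_
    simp [Equiv.Perm.permMatrix, PEquiv.toMatrix_apply, Equiv.toPEquiv_apply]
  calc ∑ a, ∑ b, (∑ σ, c σ • σ.permMatrix ℝ) a b * (f a * g b)
      = ∑ σ, c σ * ∑ a, ∑ b, (σ.permMatrix ℝ) a b * (f a * g b) := by
        simp only [Matrix.sum_apply, Matrix.smul_apply, smul_eq_mul, Finset.sum_mul,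
          Finset.mul_sum, mul_assoc]
        rw [Finset.sum_comm' (t' := Finset.univ) (s' := fun _ => Finset.univ) (by simp)]
        rw [Finset.sum_comm]
        conv_rhs => rw [Finset.sum_comm]
        refine Finset.sum_congr rfl fun σ _ => ?_
        rw [Finset.sum_comm]
    _ ≤ ∑ σ, c σ * ∑ a, f a * g a :=
        Finset.sum_le_sum fun σ _ => mul_le_mul_of_nonneg_left (h1 σ) (hc σ)
    _ = _ := by rw [← Finset.sum_mul, hc1, one_mul]

theorem pow_unitary_conj_rdiag {U : Matrix (Fin n) (Fin n) ℂ} (hU : Uᴴ * U = 1)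
    (α : Fin n → ℝ) (k : ℕ) :
    (U * rdiag α * Uᴴ) ^ k = U * rdiag (fun i => α i ^ k) * Uᴴ := by
  have := aeval_unitary_conj_rdiag hU α (Polynomial.X ^ k)
  simpa using this

theorem IsSVD.conjTranspose_mul_self_pow {X V U : Matrix (Fin n) (Fin n) ℂ} {α : Fin n → ℝ}
    (h : IsSVD X V U α) (k : ℕ) :
    (Xᴴ * X) ^ k = U * rdiag (fun i => α i ^ (2 * k)) * Uᴴ := by
  rw [h.conjTranspose_mul_self, pow_unitary_conj_rdiag h.right]
  simp only [pow_mul]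

theorem trace_unitary_conj_mul {U V : Matrix (Fin n) (Fin n) ℂ} (f g : Fin n → ℝ) :
    trace ((U * rdiag f * Uᴴ) * (V * rdiag g * Vᴴ)) =
      ((∑ a, ∑ b, ‖(Uᴴ * V) a b‖ ^ 2 * (f a * g b) : ℝ) : ℂ) := by
  have h1 : trace ((U * rdiag f * Uᴴ) * (V * rdiag g * Vᴴ)) =
      trace ((Uᴴ * V)ᴴ * (rdiag f * (Uᴴ * V) * rdiag g)) := by
    rw [trace_mul_comm, conjTranspose_mul, conjTranspose_conjTranspose]
    have : (V * rdiag g * Vᴴ) * (U * rdiag f * Uᴴ) =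
        (V * rdiag g) * ((Vᴴ * U) * rdiag f * Uᴴ) := by simp only [mul_assoc]
    rw [this, trace_mul_comm]
    simp only [mul_assoc]
  rw [h1, trace_conjTranspose_mul_eq_sum]
  push_cast
  refine Finset.sum_congr rfl fun a _ => Finset.sum_congr rfl fun b _ => ?_
  rw [mul_rdiag_apply, rdiag_mul_apply, ← Complex.conj_mul' ((Uᴴ * V) a b)]
  simp only [RCLike.star_def]
  ring

theorem trace_unitary_conj_mul_same {U : Matrix (Fin n) (Fin n) ℂ} (hU : Uᴴ * U = 1)
    (f g : Fin n → ℝ) :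
    trace ((U * rdiag f * Uᴴ) * (U * rdiag g * Uᴴ)) = ((∑ a, f a * g a : ℝ) : ℂ) := by
  rw [trace_unitary_conj_mul, hU]
  congr 1
  refine Finset.sum_congr rfl fun a _ => ?_
  rw [Finset.sum_eq_single a]
  · simp
  · intro b _ hb
    simp [one_apply_ne hb.symm]
  · simp

theorem isometry_conjTranspose_mul {U V : Matrix (Fin n) (Fin n) ℂ} (hU : Uᴴ * U = 1)
    (hV : Vᴴ * V = 1) : (Uᴴ * V)ᴴ * (Uᴴ * V) = 1 := by
  rw [conjTranspose_mul, conjTranspose_conjTranspose, mul_assoc, ← mul_assoc U,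
    mul_eq_one_comm.1 hU, one_mul, hV]

theorem re_trace_cfc_mul {φ : ℝ → ℝ} {X V U : Matrix (Fin n) (Fin n) ℂ} {α : Fin n → ℝ}
    (h : IsSVD X V U α) (k : ℕ) :
    (trace (cfc φ (matAbs X) * ((Xᴴ * X) ^ k - (X * Xᴴ) ^ k))).re =
      ∑ a, φ (α a) * α a ^ (2 * k) -
        ∑ a, ∑ b, ‖(Uᴴ * V) a b‖ ^ 2 * (φ (α a) * α b ^ (2 * k)) := by
  have h2 := h.conjTranspose.conjTranspose_mul_self_pow k
  rw [conjTranspose_conjTranspose] at h2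
  rw [mul_sub, trace_sub, h.cfc_matAbs, h.conjTranspose_mul_self_pow, h2,
    trace_unitary_conj_mul_same h.right, trace_unitary_conj_mul, Complex.sub_re,
    Complex.ofReal_re, Complex.ofReal_re]

/-- On singular values, `φ` and the even powers are similarly ordered, so the matched sum dominates
the one mixed by the overlaps of `U` and `V`. -/
theorem re_trace_cfc_mul_nonneg {φ : ℝ → ℝ} {s : Set ℝ} (hφ : MonotoneOn φ s)
    {X V U : Matrix (Fin n) (Fin n) ℂ} {α : Fin n → ℝ} (h : IsSVD X V U α) (hα : ∀ i, α i ∈ s)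
    (k : ℕ) : 0 ≤ (trace (cfc φ (matAbs X) * ((Xᴴ * X) ^ k - (X * Xᴴ) ^ k))).re := by
  rw [re_trace_cfc_mul h, sub_nonneg]
  refine sum_doublyStochastic_le (f := fun a => φ (α a)) (g := fun a => α a ^ (2 * k)) ?_
    (normSq_mem_doublyStochastic (isometry_conjTranspose_mul h.right h.left))
  intro i j hij
  exact hφ (hα i) (hα j) (lt_of_pow_lt_pow_left₀ _ (h.nonneg j) hij).le

/-- There are finitely many pairs, so a small `ε` serves them all. This slack allows a multiple of
`f` to be subtracted from `g` without spoiling the common ordering. -/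
theorem exists_pos_mul_sub_le {f g : Fin n → ℝ} (hfg : ∀ i j, f i < f j → g i < g j) :
    ∃ ε > 0, ∀ i j, f i < f j → ε * (f j - f i) ≤ g j - g i := by
  have h1 : ∀ i j, ∀ᶠ ε : ℝ in 𝓝[>] 0, f i < f j → ε * (f j - f i) ≤ g j - g i := by
    intro i j
    by_cases hij : f i < f j
    · have ht : Tendsto (fun ε : ℝ => ε * (f j - f i)) (𝓝[>] 0) (𝓝 (0 * (f j - f i))) :=
        (tendsto_id.mono_left nhdsWithin_le_nhds).mul_const _
      rw [zero_mul] at ht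
      filter_upwards [ht.eventually_lt_const (sub_pos.2 (hfg i j hij))] with ε hε _ using hε.le
    · exact Eventually.of_forall fun _ h => absurd h hij
  have h2 : ∀ᶠ ε : ℝ in 𝓝[>] 0, ∀ i j, f i < f j → ε * (f j - f i) ≤ g j - g i :=
    eventually_all.2 fun i => eventually_all.2 fun j => h1 i j
  obtain ⟨ε, hε, hpos⟩ := (h2.and self_mem_nhdsWithin).exists
  exact ⟨ε, hpos, hε⟩

/-- The equality case of the trace inequality: the functions of the two absolute values agree. -/
theorem cfc_matAbs_eq_of_re_trace_eq_zero {φ : ℝ → ℝ} {s : Set ℝ} (hφ : MonotoneOn φ s)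
    {X V U : Matrix (Fin n) (Fin n) ℂ} {α : Fin n → ℝ} (h : IsSVD X V U α) (hα : ∀ i, α i ∈ s)
    (h0 : (trace (cfc φ (matAbs X) * (Xᴴ * X - X * Xᴴ))).re = 0) :
    cfc φ (matAbs X) = cfc φ (matAbs Xᴴ) := by
  have h0' := re_trace_cfc_mul (φ := φ) h 1
  rw [pow_one, pow_one, h0, mul_one] at h0'
  set f : Fin n → ℝ := fun a => φ (α a) with hf
  set g : Fin n → ℝ := fun a => α a ^ 2 with hg
  set w : Matrix (Fin n) (Fin n) ℝ := Matrix.of fun a b => ‖(Uᴴ * V) a b‖ ^ 2 with hw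
  have hwd : w ∈ doublyStochastic ℝ (Fin n) :=
    normSq_mem_doublyStochastic (isometry_conjTranspose_mul h.right h.left)
  have hfg : ∀ i j, f i < f j → g i < g j := fun i j hij => by
    have : α i < α j := by
      by_contra hcon
      exact absurd (hφ (hα j) (hα i) (not_lt.1 hcon)) (not_le.2 hij)
    exact pow_lt_pow_left₀ this (h.nonneg i) two_ne_zero
  obtain ⟨ε, hε, hle⟩ := exists_pos_mul_sub_le hfg
  -- Rearrangement for `f` against `g - εf`, combined with equality for `g`, gives `∑ f² ≤ ∑ w f f`.
  -- This forces the nonnegative sum `∑ w (f a - f b)²` to vanish.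
  have hmono : Monovary f (fun a => g a - ε * f a) := by
    intro i j hij
    by_contra hcon
    have := hle j i (not_le.1 hcon)
    simp only at hij
    linarith
  have h1 := sum_doublyStochastic_le hmono hwd
  have h2 : ∑ a, f a * g a = ∑ a, ∑ b, w a b * (f a * g b) := by
    simp only [hw, of_apply]
    linarith
  have h3 : ∑ a, f a ^ 2 ≤ ∑ a, ∑ b, w a b * (f a * f b) := by
    have e1 : ∑ a, ∑ b, w a b * (f a * (g b - ε * f b)) =
        ∑ a, ∑ b, w a b * (f a * g b) - ε * ∑ a, ∑ b, w a b * (f a * f b) := by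
      simp only [Finset.mul_sum, ← Finset.sum_sub_distrib]
      refine Finset.sum_congr rfl fun a _ => Finset.sum_congr rfl fun b _ => by ring
    have e2 : ∑ a, f a * (g a - ε * f a) = ∑ a, f a * g a - ε * ∑ a, f a ^ 2 := by
      simp only [Finset.mul_sum, ← Finset.sum_sub_distrib]
      refine Finset.sum_congr rfl fun a _ => by ring
    rw [e1, e2] at h1
    have : ε * ∑ a, f a ^ 2 ≤ ε * ∑ a, ∑ b, w a b * (f a * f b) := by linarith
    exact le_of_mul_le_mul_left this hε
  have hrow := (mem_doublyStochastic_iff_sum.1 hwd).2.1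
  have hcol := (mem_doublyStochastic_iff_sum.1 hwd).2.2
  have h4 : ∑ a, ∑ b, w a b * (f a - f b) ^ 2 =
      2 * ∑ a, f a ^ 2 - 2 * ∑ a, ∑ b, w a b * (f a * f b) := by
    have e1 : ∑ a, ∑ b, w a b * f a ^ 2 = ∑ a, f a ^ 2 := by
      simp only [← Finset.sum_mul, hrow, one_mul]
    have e2 : ∑ a, ∑ b, w a b * f b ^ 2 = ∑ a, f a ^ 2 := by
      rw [Finset.sum_comm]
      simp only [← Finset.sum_mul, hcol, one_mul]
    rw [two_mul (∑ a, f a ^ 2)]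
    nth_rewrite 1 [← e1]
    rw [← e2]
    simp only [Finset.mul_sum, ← Finset.sum_sub_distrib, ← Finset.sum_add_distrib]
    refine Finset.sum_congr rfl fun a _ => Finset.sum_congr rfl fun b _ => by ring
  rw [← sub_eq_zero, ← norm_eq_zero, ← sq_eq_zero_iff, h.cfc_matAbs, h.conjTranspose.cfc_matAbs,
    norm_sub_sq_conj h.right h.left]
  have h5 : ∑ a, ∑ b, ‖(φ (α a) : ℂ) * (Uᴴ * V) a b - (Uᴴ * V) a b * φ (α b)‖ ^ 2 =
      ∑ a, ∑ b, w a b * (f a - f b) ^ 2 := by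
    refine Finset.sum_congr rfl fun a _ => Finset.sum_congr rfl fun b _ => ?_
    rw [mul_comm _ (φ (α b) : ℂ), ← sub_mul, norm_mul, mul_pow, mul_comm, ← sq_abs (f a - f b)]
    simp only [hw, of_apply, hf]
    norm_cast
  rw [h5]
  refine le_antisymm (by linarith) ?_
  rw [← h5]
  positivity

/-- The minus sign in front of `φ₂(|Xᴴ|)` is absorbed by exchanging `X` and `Xᴴ`, so both terms fall
under the same one-function inequality. -/
theorem re_trace_phiMat_mul (φ₁ φ₂ : ℝ → ℝ) (X : Matrix (Fin n) (Fin n) ℂ) (k : ℕ) :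
    (trace (phiMat φ₁ φ₂ X * ((Xᴴ * X) ^ k - (X * Xᴴ) ^ k))).re =
      (trace (cfc φ₁ (matAbs X) * ((Xᴴ * X) ^ k - (X * Xᴴ) ^ k))).re +
      (trace (cfc φ₂ (matAbs Xᴴ) * ((Xᴴᴴ * Xᴴ) ^ k - (Xᴴ * Xᴴᴴ) ^ k))).re := by
  rw [← Complex.add_re, ← trace_add, phiMat, conjTranspose_conjTranspose]
  congr 2
  noncomm_ring

theorem re_trace_phiMat_mul_nonneg {φ₁ φ₂ : ℝ → ℝ} {s : Set ℝ} (h₁ : MonotoneOn φ₁ s)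
    (h₂ : MonotoneOn φ₂ s) {X V U : Matrix (Fin n) (Fin n) ℂ} {α : Fin n → ℝ}
    (h : IsSVD X V U α) (hα : ∀ i, α i ∈ s) (k : ℕ) :
    0 ≤ (trace (phiMat φ₁ φ₂ X * ((Xᴴ * X) ^ k - (X * Xᴴ) ^ k))).re := by
  rw [re_trace_phiMat_mul]
  exact add_nonneg (re_trace_cfc_mul_nonneg h₁ h hα k)
    (re_trace_cfc_mul_nonneg h₂ h.conjTranspose hα k)

/-- Both nonnegative terms vanish, so a nonzero overlap of two singular vectors forces equal values
of `φ₁` and of `φ₂`. Strict monotonicity of the sum makes the singular values equal, hence `XᴴX =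
XXᴴ`. -/
theorem isStarNormal_of_re_trace_eq_zero {φ₁ φ₂ : ℝ → ℝ} {a b : ℝ} (hC : CondC0 φ₁ φ₂ a b)
    {X : Matrix (Fin n) (Fin n) ℂ} (hX : X ∈ matIcc n a b)
    (h0 : (trace (phiMat φ₁ φ₂ X * (Xᴴ * X - X * Xᴴ))).re = 0) : IsStarNormal X := by
  obtain ⟨V, U, α, h⟩ := exists_isSVD X
  have hα := (h.mem_matIcc_iff a b).1 hX
  have e := re_trace_phiMat_mul φ₁ φ₂ X 1
  have p1 := re_trace_cfc_mul_nonneg hC.monotoneOn₁ h hα 1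
  have p2 := re_trace_cfc_mul_nonneg hC.monotoneOn₂ h.conjTranspose hα 1
  simp only [pow_one] at e p1 p2
  have q1 := cfc_matAbs_eq_of_re_trace_eq_zero hC.monotoneOn₁ h hα (by linarith)
  have q2 := cfc_matAbs_eq_of_re_trace_eq_zero hC.monotoneOn₂ h.conjTranspose hα (by linarith)
  rw [conjTranspose_conjTranspose] at q2
  have entry : ∀ φ : ℝ → ℝ, cfc φ (matAbs X) = cfc φ (matAbs Xᴴ) →
      ∀ i j, (φ (α i) : ℂ) * (Uᴴ * V) i j - (Uᴴ * V) i j * φ (α j) = 0 := by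
    intro φ hφ i j
    rw [h.cfc_matAbs, h.conjTranspose.cfc_matAbs, ← sub_eq_zero, ← norm_eq_zero, ← sq_eq_zero_iff,
      norm_sub_sq_conj h.right h.left] at hφ
    have t1 := (Finset.sum_eq_zero_iff_of_nonneg (fun i _ => by positivity)).1 hφ i
      (Finset.mem_univ i)
    have t2 := (Finset.sum_eq_zero_iff_of_nonneg (fun j _ => by positivity)).1 t1 j
      (Finset.mem_univ j)
    exact norm_eq_zero.1 (sq_eq_zero_iff.1 t2)
  have key : ∀ i j, (Uᴴ * V) i j = 0 ∨ α i = α j := by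
    intro i j
    by_cases hij : (Uᴴ * V) i j = 0
    · exact Or.inl hij
    · have r1 := entry φ₁ q1 i j
      have r2 := entry φ₂ q2.symm i j
      rw [mul_comm _ (φ₁ (α j) : ℂ), ← sub_mul] at r1
      rw [mul_comm _ (φ₂ (α j) : ℂ), ← sub_mul] at r2
      have s1 := (mul_eq_zero.1 r1).resolve_right hij
      have s2 := (mul_eq_zero.1 r2).resolve_right hij
      have s1' : φ₁ (α i) - φ₁ (α j) = 0 := by exact_mod_cast s1
      have s2' : φ₂ (α i) - φ₂ (α j) = 0 := by exact_mod_cast s2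
      refine Or.inr (hC.strictMonoOn_add.injOn (hα i) (hα j) ?_)
      linarith
  have hE : Xᴴ * X = X * Xᴴ := by
    have h2 := h.conjTranspose.conjTranspose_mul_self
    rw [conjTranspose_conjTranspose] at h2
    rw [h.conjTranspose_mul_self, h2, ← sub_eq_zero, ← norm_eq_zero, ← sq_eq_zero_iff,
      norm_sub_sq_conj h.right h.left]
    refine Finset.sum_eq_zero fun i _ => Finset.sum_eq_zero fun j _ => ?_
    rcases key i j with hz | hz
    · simp [hz]
    · simp [hz, mul_comm]
  exact ⟨hE⟩

/-! ### Global integral curves -/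

/-- A bounded and globally Lipschitz vector field has global integral curves. -/
theorem exists_global_integralCurve {E : Type*} [NormedAddCommGroup E] [NormedSpace ℝ E]
    [CompleteSpace E] {F : E → E} {K L : NNReal} (hF : LipschitzWith K F)
    (hL : ∀ x, ‖F x‖ ≤ L) (x₀ : E) :
    ∃ X : ℝ → E, X 0 = x₀ ∧ ∀ t, HasDerivAt X (F (X t)) t := by
  have h1 : ∀ m : ℕ, ∃ α : ℝ → E, α 0 = x₀ ∧
      ∀ t ∈ Ioo (-(m + 1 : ℝ)) (m + 1), HasDerivAt α (F (α t)) t := by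
    intro m
    have hmem : (0 : ℝ) ∈ Icc (-(m + 1 : ℝ)) (m + 1) := by
      constructor <;> [linarith [Nat.cast_nonneg (α := ℝ) m]; positivity]
    -- Since the field is bounded by `L`, a ball of radius `L(m + 1)` cannot be left within time `m
    -- + 1`, so Picard–Lindelöf covers the whole interval.
    have hP : IsPicardLindelof (fun _ : ℝ => F) (⟨0, hmem⟩ : Icc (-(m + 1 : ℝ)) (m + 1)) x₀
        (L * (m + 1)) 0 L K :=
      { lipschitzOnWith := fun t _ => hF.lipschitzOnWith
        continuousOn := fun x _ => continuousOn_const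
        norm_le := fun t _ x _ => hL x
        mul_max_le := by simp }
    obtain ⟨α, h0, hα⟩ := hP.exists_eq_forall_mem_Icc_hasDerivWithinAt₀
    exact ⟨α, h0, fun t ht => (hα t (Ioo_subset_Icc_self ht)).hasDerivAt (Icc_mem_nhds ht.1 ht.2)⟩
  choose α h0 hα using h1
  have huniq : ∀ m k : ℕ, ∀ t : ℝ, |t| < m + 1 → |t| < k + 1 → α m t = α k t := by
    have key : ∀ m k : ℕ, m ≤ k → ∀ t : ℝ, |t| < m + 1 → α m t = α k t := by
      intro m k hmk t htm
      have hmk' : (m : ℝ) ≤ k := by exact_mod_cast hmk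
      refine ODE_solution_unique_of_mem_Ioo (v := fun _ => F) (s := fun _ => univ) (K := K)
        (a := -(m + 1 : ℝ)) (b := m + 1) (t₀ := 0) (fun _ _ => hF.lipschitzOnWith) ?_
        (fun t ht => ⟨hα m t ht, mem_univ _⟩) (fun t ht => ⟨hα k t ?_, mem_univ _⟩)
        ((h0 m).trans (h0 k).symm) (abs_lt.1 htm)
      · constructor <;> [linarith [Nat.cast_nonneg (α := ℝ) m]; positivity]
      · exact ⟨by linarith [ht.1], by linarith [ht.2]⟩
    intro m k t hm hk
    rcases le_total m k with h | h
    · exact key m k h t hm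
    · exact (key k m h t hk).symm
  -- The glued curve locally agrees with a single `α m`, because the solutions coincide on common
  -- intervals.
  refine ⟨fun t => α ⌈|t|⌉₊ t, by simp [h0], fun t => ?_⟩
  have hlt : ∀ s : ℝ, |s| < (⌈|s|⌉₊ : ℝ) + 1 := fun s => (Nat.le_ceil _).trans_lt (lt_add_one _)
  have hev : (fun s => α ⌈|s|⌉₊ s) =ᶠ[𝓝 t] α ⌈|t|⌉₊ := by
    have : ∀ᶠ s in 𝓝 t, |s| < (⌈|t|⌉₊ : ℝ) + 1 :=
      continuous_abs.continuousAt.eventually_lt_const (hlt t)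
    filter_upwards [this] with s hs
    exact huniq _ _ s (hlt s) hs
  exact (hα _ t (abs_lt.1 (hlt t))).congr_of_eventuallyEq hev

/-! ### Power traces and the set `matIcc` -/

theorem phiMat_isHermitian (φ₁ φ₂ : ℝ → ℝ) (X : Matrix (Fin n) (Fin n) ℂ) :
    (phiMat φ₁ φ₂ X)ᴴ = phiMat φ₁ φ₂ X := by
  have h1 : (cfc φ₁ (matAbs X))ᴴ = cfc φ₁ (matAbs X) := cfc_predicate φ₁ (matAbs X)
  have h2 : (cfc φ₂ (matAbs Xᴴ))ᴴ = cfc φ₂ (matAbs Xᴴ) := cfc_predicate φ₂ (matAbs Xᴴ)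
  rw [phiMat, conjTranspose_sub, h1, h2]

/-- The real part of the trace, as a continuous real-linear functional. -/
noncomputable def reTrace (n : ℕ) : Matrix (Fin n) (Fin n) ℂ →L[ℝ] ℝ :=
  LinearMap.toContinuousLinearMap
    (Complex.reLm ∘ₗ (traceLinearMap (Fin n) ℂ ℂ).restrictScalars ℝ)

theorem reTrace_apply (A : Matrix (Fin n) (Fin n) ℂ) : reTrace n A = (trace A).re := rfl

theorem HasDerivAt.matrix_conjTranspose {X : ℝ → Matrix (Fin n) (Fin n) ℂ}
    {X' : Matrix (Fin n) (Fin n) ℂ} {t : ℝ} (h : HasDerivAt X X' t) :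
    HasDerivAt (fun t => (X t)ᴴ) X'ᴴ t :=
  h.star

theorem mul_conjTranspose_pow_succ (X : Matrix (Fin n) (Fin n) ℂ) (k : ℕ) :
    X * (Xᴴ * X) ^ k * Xᴴ = (X * Xᴴ) ^ (k + 1) := by
  induction k with
  | zero => simp
  | succ k ih =>
    rw [pow_succ (X * Xᴴ), ← ih, pow_succ]
    simp only [mul_assoc]

/-- Cyclicity of the trace makes all the Leibniz terms equal. The scalar `c` accommodates the radial
cutoff of the field. -/
theorem hasDerivAt_reTrace_pow {X : ℝ → Matrix (Fin n) (Fin n) ℂ} {t c : ℝ}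
    {S : Matrix (Fin n) (Fin n) ℂ} (hS : Sᴴ = S)
    (h : HasDerivAt X (c • (S * X t - X t * S)) t) (k : ℕ) :
    HasDerivAt (fun t => reTrace n (((X t)ᴴ * X t) ^ (k + 1)))
      (-(2 * (k + 1) * c) *
        (trace (S * (((X t)ᴴ * X t) ^ (k + 1) - (X t * (X t)ᴴ) ^ (k + 1)))).re) t := by
  have h1 := ((h.matrix_conjTranspose.mul h).fun_pow' (k + 1))
  have h2 := (reTrace n).hasFDerivAt.comp_hasDerivAt t h1
  refine h2.congr_deriv ?_
  set Y := X t
  set H' := (c • (S * Y - Y * S))ᴴ * Y + Yᴴ * c • (S * Y - Y * S) with hH'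
  have e1 : ∀ i ∈ Finset.range (k + 1),
      reTrace n ((Yᴴ * Y) ^ ((k + 1).pred - i) * H' * (Yᴴ * Y) ^ i) =
        reTrace n ((Yᴴ * Y) ^ k * H') := by
    intro i hi
    have hik : i ≤ k := Nat.lt_succ_iff.1 (Finset.mem_range.1 hi)
    rw [reTrace_apply, reTrace_apply, trace_mul_comm, ← mul_assoc, ← pow_add, Nat.pred_succ,
      Nat.add_sub_cancel' hik]
  have e2 : H' = c • (2 • (Yᴴ * S * Y) - S * (Yᴴ * Y) - (Yᴴ * Y) * S) := by
    rw [hH', conjTranspose_smul, conjTranspose_sub, conjTranspose_mul, conjTranspose_mul, hS,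
      star_trivial, smul_mul_assoc, mul_smul_comm, ← smul_add]
    congr 1
    noncomm_ring
  have e3 : trace ((Yᴴ * Y) ^ k * H') =
      -(2 * c) * trace (S * ((Yᴴ * Y) ^ (k + 1) - (Y * Yᴴ) ^ (k + 1))) := by
    have f1 : trace ((Yᴴ * Y) ^ k * (Yᴴ * S * Y)) = trace (S * (Y * Yᴴ) ^ (k + 1)) := by
      rw [← mul_conjTranspose_pow_succ, trace_mul_comm S]
      have : (Yᴴ * Y) ^ k * (Yᴴ * S * Y) = ((Yᴴ * Y) ^ k * Yᴴ * S) * Y := by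
        simp only [mul_assoc]
      rw [this, trace_mul_comm]
      simp only [mul_assoc]
    have f2 : trace ((Yᴴ * Y) ^ k * (S * (Yᴴ * Y))) = trace (S * (Yᴴ * Y) ^ (k + 1)) := by
      rw [trace_mul_comm, mul_assoc, ← pow_succ']
    have f3 : trace ((Yᴴ * Y) ^ k * ((Yᴴ * Y) * S)) = trace (S * (Yᴴ * Y) ^ (k + 1)) := by
      rw [← mul_assoc, ← pow_succ, trace_mul_comm]
    rw [e2, mul_smul_comm, trace_smul, mul_sub, mul_sub, trace_sub, trace_sub, mul_smul_comm,
      trace_smul, f1, f2, f3, mul_sub, trace_sub, Complex.real_smul]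
    simp only [nsmul_eq_mul, Nat.cast_ofNat]
    ring
  have e4 : reTrace n ((Yᴴ * Y) ^ k * H') =
      -(2 * c) * (trace (S * ((Yᴴ * Y) ^ (k + 1) - (Y * Yᴴ) ^ (k + 1)))).re := by
    rw [reTrace_apply, e3]
    have : (-(2 * c) : ℂ) = ((-(2 * c) : ℝ) : ℂ) := by push_cast; ring
    rw [this, Complex.re_ofReal_mul]
  refine (map_sum (reTrace n) _ _).trans ((Finset.sum_congr rfl e1).trans ?_)
  rw [Finset.sum_const, Finset.card_range, e4]
  simp only [nsmul_eq_mul]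
  push_cast
  ring

theorem IsSVD.reTrace_pow {X V U : Matrix (Fin n) (Fin n) ℂ} {α : Fin n → ℝ}
    (h : IsSVD X V U α) (k : ℕ) : reTrace n ((Xᴴ * X) ^ k) = ∑ i, α i ^ (2 * k) := by
  rw [reTrace_apply, h.conjTranspose_mul_self_pow, trace_mul_comm, ← mul_assoc, h.right, one_mul,
    rdiag, trace_diagonal, Complex.re_sum]
  refine Finset.sum_congr rfl fun i _ => ?_
  rw [Complex.ofReal_re]

theorem reTrace_pow_le_of_mem_matIcc {b : ℝ} {X : Matrix (Fin n) (Fin n) ℂ}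
    (hX : X ∈ matIcc n 0 b) (k : ℕ) : reTrace n ((Xᴴ * X) ^ k) ≤ n * b ^ (2 * k) := by
  obtain ⟨V, U, β, h⟩ := exists_isSVD X
  have hβ := (h.mem_matIcc_iff 0 b).1 hX
  rw [h.reTrace_pow]
  calc ∑ j, β j ^ (2 * k) ≤ ∑ j : Fin n, b ^ (2 * k) :=
        Finset.sum_le_sum fun j _ => pow_le_pow_left₀ (hβ j).1 (hβ j).2 _
    _ = _ := by simp

/-- The constraint `σ(|X|) ⊆ [0, b]` follows from bounds on all the power traces. -/
theorem mem_matIcc_of_reTrace_pow_le {b : ℝ} (hb : 0 < b) {X : Matrix (Fin n) (Fin n) ℂ}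
    (h : ∀ k : ℕ, reTrace n ((Xᴴ * X) ^ (k + 1)) ≤ n * b ^ (2 * (k + 1))) :
    X ∈ matIcc n 0 b := by
  obtain ⟨V, U, α, hX⟩ := exists_isSVD X
  refine (hX.mem_matIcc_iff 0 b).2 fun i => ⟨hX.nonneg i, ?_⟩
  by_contra hcon
  -- A ratio above 1 has powers exceeding `n`, while the trace bounds keep its even powers at most
  -- `n`.
  have hr : 1 < α i / b := (one_lt_div hb).2 (not_le.1 hcon)
  obtain ⟨k, hk⟩ := pow_unbounded_of_one_lt (n : ℝ) hr
  have h1 : α i ^ (2 * (k + 1)) ≤ n * b ^ (2 * (k + 1)) := by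
    refine le_trans ?_ (h k)
    rw [hX.reTrace_pow]
    exact Finset.single_le_sum (f := fun j => α j ^ (2 * (k + 1)))
      (fun j _ => pow_nonneg (hX.nonneg j) _) (Finset.mem_univ i)
  have h2 : (α i / b) ^ (2 * (k + 1)) ≤ n := by
    rw [div_pow]
    exact (div_le_iff₀ (by positivity)).2 h1
  have h3 : (α i / b) ^ k ≤ (α i / b) ^ (2 * (k + 1)) := pow_le_pow_right₀ hr.le (by omega)
  linarith

theorem continuous_reTrace_pow (k : ℕ) :
    Continuous fun X : Matrix (Fin n) (Fin n) ℂ => reTrace n ((Xᴴ * X) ^ k) :=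
  (reTrace n).continuous.comp ((continuous_id.matrix_conjTranspose.mul continuous_id).pow k)

/-- The set is cut out by closed conditions on the power traces, so no continuity of the spectrum is
required. -/
theorem isClosed_matIcc {b : ℝ} (hb : 0 < b) : IsClosed (matIcc n 0 b) := by
  have : matIcc n 0 b = ⋂ k : ℕ, {X | reTrace n ((Xᴴ * X) ^ (k + 1)) ≤ n * b ^ (2 * (k + 1))} := by
    ext X
    simp only [mem_iInter, mem_ofPred_eq]
    exact ⟨fun h k => reTrace_pow_le_of_mem_matIcc h _, mem_matIcc_of_reTrace_pow_le hb⟩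
  rw [this]
  exact isClosed_iInter fun k => isClosed_le (continuous_reTrace_pow (k + 1)) continuous_const

/-! ### The truncated field and well-posedness -/

/-- Radial retraction onto the ball of radius `R`. -/
noncomputable def radialCut (R : ℝ) (X : Matrix (Fin n) (Fin n) ℂ) : Matrix (Fin n) (Fin n) ℂ :=
  (R / max R ‖X‖) • X

theorem norm_radialCut_le {R : ℝ} (hR : 0 < R) (X : Matrix (Fin n) (Fin n) ℂ) :
    ‖radialCut R X‖ ≤ R := by
  have hm : 0 < max R ‖X‖ := lt_max_of_lt_left hR
  rw [radialCut, norm_smul, Real.norm_of_nonneg (by positivity), div_mul_eq_mul_div, div_le_iff₀ hm]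
  exact mul_le_mul_of_nonneg_left (le_max_right _ _) hR.le

theorem radialCut_eq_self {R : ℝ} (hR : 0 < R) {X : Matrix (Fin n) (Fin n) ℂ} (hX : ‖X‖ ≤ R) :
    radialCut R X = X := by
  rw [radialCut, max_eq_left hX, div_self hR.ne', one_smul]

theorem norm_radialCut_sub_le {R : ℝ} (hR : 0 < R) (X Y : Matrix (Fin n) (Fin n) ℂ) :
    ‖radialCut R X - radialCut R Y‖ ≤ 2 * ‖X - Y‖ := by
  set a := max R ‖X‖ with ha
  set c := max R ‖Y‖ with hc
  have ha0 : 0 < a := lt_max_of_lt_left hR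
  have hc0 : 0 < c := lt_max_of_lt_left hR
  have e : radialCut R X - radialCut R Y = (R / a) • (X - Y) + (R / a - R / c) • Y := by
    simp only [radialCut, ← ha, ← hc, smul_sub, sub_smul]; abel
  have h1 : ‖(R / a) • (X - Y)‖ ≤ ‖X - Y‖ := by
    rw [norm_smul, Real.norm_of_nonneg (by positivity)]
    exact mul_le_of_le_one_left (norm_nonneg _) ((div_le_one ha0).2 (le_max_left _ _))
  have h2 : ‖(R / a - R / c) • Y‖ ≤ ‖X - Y‖ := by
    have e2 : R / a - R / c = (R / a) * ((c - a) / c) := by field_simp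
    rw [norm_smul, e2, norm_mul, Real.norm_of_nonneg (by positivity : 0 ≤ R / a), norm_div,
      Real.norm_of_nonneg hc0.le]
    have h3 : ‖c - a‖ ≤ ‖X - Y‖ := by
      have : |c - a| ≤ |‖Y‖ - ‖X‖| := by
        rw [hc, ha]
        have := abs_max_sub_max_le_max R ‖Y‖ R ‖X‖
        simpa using this
      exact this.trans ((abs_norm_sub_norm_le Y X).trans_eq (norm_sub_rev _ _))
    have h4 : R / a ≤ 1 := (div_le_one ha0).2 (le_max_left _ _)
    have h5 : ‖Y‖ / c ≤ 1 := (div_le_one hc0).2 (le_max_right _ _)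
    calc R / a * (‖c - a‖ / c) * ‖Y‖ = (R / a) * ‖c - a‖ * (‖Y‖ / c) := by ring
      _ ≤ 1 * ‖X - Y‖ * 1 := by gcongr
      _ = _ := by ring
  rw [e]
  refine (norm_add_le _ _).trans ?_
  linarith

theorem norm_commutator_sub_le {A B A' B' : Matrix (Fin n) (Fin n) ℂ} {M R LA LB d : ℝ}
    (hA : ‖A‖ ≤ M) (hB' : ‖B'‖ ≤ R) (hAA : ‖A - A'‖ ≤ LA * d) (hBB : ‖B - B'‖ ≤ LB * d) :
    ‖(A * B - B * A) - (A' * B' - B' * A')‖ ≤ 2 * (M * LB + LA * R) * d := by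
  have hM : 0 ≤ M := (norm_nonneg _).trans hA
  have hR : 0 ≤ R := (norm_nonneg _).trans hB'
  have hA0 : 0 ≤ LA * d := (norm_nonneg _).trans hAA
  have hB0 : 0 ≤ LB * d := (norm_nonneg _).trans hBB
  have e : (A * B - B * A) - (A' * B' - B' * A') =
      (A * (B - B') + (A - A') * B') - ((B - B') * A + B' * (A - A')) := by noncomm_ring
  have h1 : ‖A * (B - B')‖ ≤ M * (LB * d) :=
    (norm_mul_le _ _).trans (mul_le_mul hA hBB (norm_nonneg _) hM)
  have h2 : ‖(A - A') * B'‖ ≤ (LA * d) * R :=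
    (norm_mul_le _ _).trans (mul_le_mul hAA hB' (norm_nonneg _) hA0)
  have h3 : ‖(B - B') * A‖ ≤ (LB * d) * M :=
    (norm_mul_le _ _).trans (mul_le_mul hBB hA (norm_nonneg _) hB0)
  have h4 : ‖B' * (A - A')‖ ≤ R * (LA * d) :=
    (norm_mul_le _ _).trans (mul_le_mul hB' hAA (norm_nonneg _) hR)
  rw [e]
  refine (norm_sub_le _ _).trans ?_
  refine (add_le_add (norm_add_le _ _) (norm_add_le _ _)).trans ?_
  linarith

/-- The extension of a function on `[0, b]` to `[0, ∞)` that is constant on `[b, ∞)`. -/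
def clampRight (b : ℝ) (φ : ℝ → ℝ) (x : ℝ) : ℝ := φ (min b x)

theorem min_mem_Icc {b x : ℝ} (hb : 0 < b) (hx : 0 ≤ x) : min b x ∈ Icc 0 b :=
  ⟨le_min hb.le hx, min_le_left _ _⟩

theorem clampRight_eq {b x : ℝ} (φ : ℝ → ℝ) (hx : x ∈ Icc 0 b) : clampRight b φ x = φ x := by
  rw [clampRight, min_eq_right hx.2]

/-- Monotonicity on all of `[0, ∞)` makes the trace inequality available before invariance of
`matIcc` is known. -/
theorem clampRight_monotoneOn {b : ℝ} (hb : 0 < b) {φ : ℝ → ℝ} (h : MonotoneOn φ (Icc 0 b)) :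
    MonotoneOn (clampRight b φ) (Ici 0) := fun _ hx _ hy hxy =>
  h (min_mem_Icc hb hx) (min_mem_Icc hb hy) (min_le_min_left b hxy)

theorem abs_clampRight_sub_le {b : ℝ} (hb : 0 < b) {φ : ℝ → ℝ} {K : NNReal} {L : ℝ} (hKL : K ≤ L)
    (h : LipschitzOnWith K φ (Icc 0 b)) (x : ℝ) (hx : 0 ≤ x) (y : ℝ) (hy : 0 ≤ y) :
    |clampRight b φ x - clampRight b φ y| ≤ L * |x - y| := by
  have h1 := h.dist_le_mul _ (min_mem_Icc hb hx) _ (min_mem_Icc hb hy)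
  rw [Real.dist_eq, Real.dist_eq] at h1
  have h2 : |min b x - min b y| ≤ |x - y| := by
    simpa using abs_min_sub_min_le_max b x b y
  calc _ ≤ K * |min b x - min b y| := h1
    _ ≤ L * |x - y| := mul_le_mul hKL h2 (abs_nonneg _) (K.2.trans hKL)

theorem abs_clampRight_le {b : ℝ} (hb : 0 < b) {φ : ℝ → ℝ} {K : NNReal} {L : ℝ} (hKL : K ≤ L)
    (h : LipschitzOnWith K φ (Icc 0 b)) (x : ℝ) (hx : 0 ≤ x) :
    |clampRight b φ x| ≤ |φ 0| + L * b := by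
  have hm := min_mem_Icc hb hx
  have h1 := h.dist_le_mul _ hm _ (⟨le_rfl, hb.le⟩ : (0 : ℝ) ∈ Icc 0 b)
  rw [Real.dist_eq, Real.dist_eq, sub_zero, abs_of_nonneg hm.1] at h1
  have h2 : |clampRight b φ x| ≤ |φ 0| + |φ (min b x) - φ 0| := by
    rw [clampRight]
    have := abs_add_le (φ 0) (φ (min b x) - φ 0)
    simpa using this
  have h3 : (K : ℝ) * min b x ≤ L * b := by
    have := hm.2
    have := hm.1
    gcongr
    exact K.2.trans hKL
  linarith

/-- Uniform Lipschitz and size bounds for the clamped functional calculus. -/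
theorem CondCL.exists_phiMat_bounds {φ₁ φ₂ : ℝ → ℝ} {b : ℝ} (hb : 0 < b)
    (hC : CondCL φ₁ φ₂ 0 b) : ∃ L M : ℝ, 0 ≤ L ∧ 0 ≤ M ∧
      (∀ X Y : Matrix (Fin n) (Fin n) ℂ,
        ‖phiMat (clampRight b φ₁) (clampRight b φ₂) X -
          phiMat (clampRight b φ₁) (clampRight b φ₂) Y‖ ≤ L * ‖X - Y‖) ∧
      ∀ X : Matrix (Fin n) (Fin n) ℂ, ‖phiMat (clampRight b φ₁) (clampRight b φ₂) X‖ ≤ M := by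
  obtain ⟨K₁, h₁⟩ := hC.lipschitz₁
  obtain ⟨K₂, h₂⟩ := hC.lipschitz₂
  set L : ℝ := max K₁ K₂
  have hL : 0 ≤ L := K₁.2.trans (le_max_left _ _)
  set M : ℝ := max |φ₁ 0| |φ₂ 0| + L * b
  have hM : 0 ≤ M := add_nonneg ((abs_nonneg _).trans (le_max_left _ _)) (by positivity)
  refine ⟨4 * L, 2 * (n * M), by positivity, by positivity, ?_, ?_⟩
  · exact norm_phiMat_sub_le hL (abs_clampRight_sub_le hb (le_max_left _ _) h₁)
      (abs_clampRight_sub_le hb (le_max_right _ _) h₂)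
  · refine norm_phiMat_le (fun x hx => ?_) (fun x hx => ?_)
    · exact (abs_clampRight_le hb (le_max_left _ _) h₁ x hx).trans
        (by simp only [M]; gcongr; exact le_max_left _ _)
    · exact (abs_clampRight_le hb (le_max_right _ _) h₂ x hx).trans
        (by simp only [M]; gcongr; exact le_max_right _ _)

theorem phiMat_clampRight {φ₁ φ₂ : ℝ → ℝ} {b : ℝ} {X : Matrix (Fin n) (Fin n) ℂ}
    (hX : X ∈ matIcc n 0 b) :
    phiMat (clampRight b φ₁) (clampRight b φ₂) X = phiMat φ₁ φ₂ X :=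
  phiMat_congr hX (fun _ hx => clampRight_eq φ₁ hx) (fun _ hx => clampRight_eq φ₂ hx)

/-- The globally Lipschitz truncation of the vector field `X ↦ [φ(X), X]`. -/
noncomputable def flowField (φ₁ φ₂ : ℝ → ℝ) (b R : ℝ) (X : Matrix (Fin n) (Fin n) ℂ) :
    Matrix (Fin n) (Fin n) ℂ :=
  phiMat (clampRight b φ₁) (clampRight b φ₂) X * radialCut R X -
    radialCut R X * phiMat (clampRight b φ₁) (clampRight b φ₂) X

theorem flowField_eq {φ₁ φ₂ : ℝ → ℝ} {b R : ℝ} (hR : 0 < R) {X : Matrix (Fin n) (Fin n) ℂ}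
    (hX : X ∈ matIcc n 0 b) (hXR : ‖X‖ ≤ R) :
    flowField φ₁ φ₂ b R X = phiMat φ₁ φ₂ X * X - X * phiMat φ₁ φ₂ X := by
  rw [flowField, radialCut_eq_self hR hXR, phiMat_clampRight hX]

/-- Existence and uniqueness of the flow on the invariant set `M_n[0, b]`. -/
theorem CondCL.exists_unique_flow {φ₁ φ₂ : ℝ → ℝ} {b : ℝ} (hb : 0 < b) (hC : CondCL φ₁ φ₂ 0 b)
    {T : Matrix (Fin n) (Fin n) ℂ} (hT : T ∈ matIcc n 0 b) :
    ∃ X : ℝ → Matrix (Fin n) (Fin n) ℂ, X 0 = T ∧ (∀ t, 0 ≤ t → X t ∈ matIcc n 0 b) ∧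
      (∀ t, 0 ≤ t → HasDerivAt X (phiMat φ₁ φ₂ (X t) * X t - X t * phiMat φ₁ φ₂ (X t)) t) ∧
      ∀ X' : ℝ → Matrix (Fin n) (Fin n) ℂ, IsGlobalSolution φ₁ φ₂ 0 b T X' →
        ∀ t, 0 ≤ t → X' t = X t := by
  obtain ⟨L, M, hL, hM, hLip, hbd⟩ := hC.exists_phiMat_bounds (n := n) hb
  -- The radius exceeds every norm in `matIcc`; the added 1 keeps it positive when `n = 0`.
  set R : ℝ := n * b + 1 with hR'
  have hR : 0 < R := by positivity
  have hnorm : ∀ X ∈ matIcc n 0 b, ‖X‖ ≤ R := fun X hX =>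
    (norm_le_of_mem_matIcc hX).trans (le_add_of_nonneg_right zero_le_one)
  have hFL : LipschitzWith (2 * (M * 2 + L * R)).toNNReal
      (flowField φ₁ φ₂ b R : Matrix (Fin n) (Fin n) ℂ → Matrix (Fin n) (Fin n) ℂ) := by
    refine LipschitzWith.of_dist_le_mul fun X Y => ?_
    rw [dist_eq_norm, dist_eq_norm, Real.coe_toNNReal _ (by positivity)]
    exact norm_commutator_sub_le (hbd X) (norm_radialCut_le hR Y) (hLip X Y)
      (norm_radialCut_sub_le hR X Y)
  have hFB : ∀ X : Matrix (Fin n) (Fin n) ℂ,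
      ‖flowField φ₁ φ₂ b R X‖ ≤ (2 * (M * R)).toNNReal := by
    intro X
    rw [Real.coe_toNNReal _ (by positivity), two_mul]
    refine (norm_sub_le _ _).trans (add_le_add ?_ ?_)
    · exact (norm_mul_le _ _).trans
        (mul_le_mul (hbd X) (norm_radialCut_le hR X) (norm_nonneg _) hM)
    · rw [mul_comm M R]
      exact (norm_mul_le _ _).trans
        (mul_le_mul (norm_radialCut_le hR X) (hbd X) (norm_nonneg _) hR.le)
  obtain ⟨X, hX0, hX⟩ := exists_global_integralCurve hFL hFB T
  -- The cutoff only rescales the commutator by a nonnegative factor, so the truncated flow still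
  -- decreases every power trace.
  have hanti : ∀ k : ℕ, Antitone fun t => reTrace n (((X t)ᴴ * X t) ^ (k + 1)) := by
    intro k
    have hd : ∀ t, HasDerivAt (fun t => reTrace n (((X t)ᴴ * X t) ^ (k + 1))) _ t := fun t =>
      hasDerivAt_reTrace_pow (c := R / max R ‖X t‖)
        (S := phiMat (clampRight b φ₁) (clampRight b φ₂) (X t)) (phiMat_isHermitian _ _ _)
        ((hX t).congr_deriv (by
          rw [flowField, radialCut, mul_smul_comm, smul_mul_assoc, smul_sub])) k
    refine antitone_of_hasDerivAt_nonpos hd fun t => ?_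
    obtain ⟨V, U, α, h⟩ := exists_isSVD (X t)
    have := re_trace_phiMat_mul_nonneg (clampRight_monotoneOn hb hC.monotoneOn₁)
      (clampRight_monotoneOn hb hC.monotoneOn₂) h h.nonneg (k + 1)
    have hc : 0 ≤ R / max R ‖X t‖ := by
      have : 0 < max R ‖X t‖ := lt_max_of_lt_left hR
      positivity
    simp only [neg_mul, Pi.zero_apply, Left.neg_nonpos_iff]
    positivity
  have hmem : ∀ t, 0 ≤ t → X t ∈ matIcc n 0 b := fun t ht =>
    mem_matIcc_of_reTrace_pow_le hb fun k => by
      have := hanti k ht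
      simp only [hX0] at this
      exact this.trans (reTrace_pow_le_of_mem_matIcc hT _)
  refine ⟨X, hX0, hmem, fun t ht => ?_, fun X' hX' t ht => ?_⟩
  · rw [← flowField_eq hR (hmem t ht) (hnorm _ (hmem t ht))]
    exact hX t
  · have hd' : ∀ s, 0 ≤ s → HasDerivWithinAt X' (flowField φ₁ φ₂ b R (X' s)) (Ici 0) s := by
      intro s hs
      rw [flowField_eq hR (hX'.mem s hs) (hnorm _ (hX'.mem s hs))]
      exact hX'.ode s hs
    refine ODE_solution_unique (v := fun _ => flowField φ₁ φ₂ b R) (a := 0) (b := t)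
      (fun _ => hFL) (fun s hs => ?_) (fun s hs => ?_)
      (fun s _ => (hX s).continuousAt.continuousWithinAt)
      (fun s _ => (hX s).hasDerivWithinAt) (hX'.init.trans hX0.symm) ⟨ht, le_rfl⟩
    · exact (hd' s hs.1).continuousWithinAt.mono Icc_subset_Ici_self
    · exact (hd' s hs.1).mono (Ici_subset_Ici.2 hs.1)

/-! ### Energy dissipation and LaSalle's principle -/

/-- `X` is a forward trajectory of `dX/dt = [φ(X), X]` inside `M_n[0, b]`. -/
structure IsTrajectory (φ₁ φ₂ : ℝ → ℝ) (b : ℝ) (X : ℝ → Matrix (Fin n) (Fin n) ℂ) : Prop where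
  mem : ∀ t, 0 ≤ t → X t ∈ matIcc n 0 b
  hasDerivAt : ∀ t, 0 ≤ t →
    HasDerivAt X (phiMat φ₁ φ₂ (X t) * X t - X t * phiMat φ₁ φ₂ (X t)) t

/-- Minus half of the derivative of the squared Frobenius norm along the flow. -/
noncomputable def dissipation (φ₁ φ₂ : ℝ → ℝ) (X : Matrix (Fin n) (Fin n) ℂ) : ℝ :=
  (trace (phiMat φ₁ φ₂ X * (Xᴴ * X - X * Xᴴ))).re

theorem CondCL.exists_norm_phiMat_le {φ₁ φ₂ : ℝ → ℝ} {b : ℝ} (hb : 0 < b)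
    (hC : CondCL φ₁ φ₂ 0 b) :
    ∃ M : ℝ, 0 ≤ M ∧ ∀ X ∈ matIcc n 0 b, ‖phiMat φ₁ φ₂ X‖ ≤ M := by
  obtain ⟨L, M, -, hM, -, hbd⟩ := hC.exists_phiMat_bounds (n := n) hb
  exact ⟨M, hM, fun X hX => by rw [← phiMat_clampRight hX]; exact hbd X⟩

theorem CondCL.continuousOn_dissipation {φ₁ φ₂ : ℝ → ℝ} {b : ℝ} (hb : 0 < b)
    (hC : CondCL φ₁ φ₂ 0 b) : ContinuousOn (dissipation φ₁ φ₂) (matIcc n 0 b) := by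
  obtain ⟨L, M, hL, -, hLip, -⟩ := hC.exists_phiMat_bounds (n := n) hb
  have h1 : Continuous (phiMat (clampRight b φ₁) (clampRight b φ₂) :
      Matrix (Fin n) (Fin n) ℂ → Matrix (Fin n) (Fin n) ℂ) := by
    refine (LipschitzWith.of_dist_le_mul (K := L.toNNReal) fun X Y => ?_).continuous
    rw [dist_eq_norm, dist_eq_norm, Real.coe_toNNReal _ hL]
    exact hLip X Y
  have h2 : Continuous fun X : Matrix (Fin n) (Fin n) ℂ =>
      reTrace n (phiMat (clampRight b φ₁) (clampRight b φ₂) X * (Xᴴ * X - X * Xᴴ)) := by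
    refine (reTrace n).continuous.comp (h1.mul ?_)
    exact (continuous_id.matrix_conjTranspose.mul continuous_id).sub
      (continuous_id.mul continuous_id.matrix_conjTranspose)
  refine h2.continuousOn.congr fun X hX => ?_
  rw [dissipation, ← phiMat_clampRight hX]
  rfl

theorem dissipation_nonneg {φ₁ φ₂ : ℝ → ℝ} {b : ℝ} (hC : CondC0 φ₁ φ₂ 0 b)
    {X : Matrix (Fin n) (Fin n) ℂ} (hX : X ∈ matIcc n 0 b) : 0 ≤ dissipation φ₁ φ₂ X := by
  obtain ⟨V, U, α, h⟩ := exists_isSVD X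
  have := re_trace_phiMat_mul_nonneg hC.monotoneOn₁ hC.monotoneOn₂ h
    ((h.mem_matIcc_iff 0 b).1 hX) 1
  rwa [pow_one, pow_one] at this

namespace IsTrajectory

variable {φ₁ φ₂ : ℝ → ℝ} {b : ℝ} {X : ℝ → Matrix (Fin n) (Fin n) ℂ}

theorem norm_le (hX : IsTrajectory φ₁ φ₂ b X) {t : ℝ} (ht : 0 ≤ t) : ‖X t‖ ≤ n * b :=
  norm_le_of_mem_matIcc (hX.mem t ht)

theorem exists_norm_sub_le (hX : IsTrajectory φ₁ φ₂ b X) (hb : 0 < b) (hC : CondCL φ₁ φ₂ 0 b) :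
    ∃ C : ℝ, 0 < C ∧ ∀ s, 0 ≤ s → ∀ t, 0 ≤ t → ‖X t - X s‖ ≤ C * |t - s| := by
  obtain ⟨M, hM, hbd⟩ := hC.exists_norm_phiMat_le (n := n) hb
  refine ⟨2 * (M * (n * b)) + 1, by positivity, fun s hs t ht => ?_⟩
  refine Convex.norm_image_sub_le_of_norm_hasDerivWithin_le
    (fun u hu => (hX.hasDerivAt u hu).hasDerivWithinAt) (fun u hu => ?_) (convex_Ici 0) hs ht
  have h1 := hbd _ (hX.mem u hu)
  have h2 := hX.norm_le hu
  have h3 : ‖phiMat φ₁ φ₂ (X u) * X u‖ ≤ M * (n * b) :=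
    (norm_mul_le _ _).trans (mul_le_mul h1 h2 (norm_nonneg _) hM)
  have h4 : ‖X u * phiMat φ₁ φ₂ (X u)‖ ≤ (n * b) * M :=
    (norm_mul_le _ _).trans (mul_le_mul h2 h1 (norm_nonneg _) (by positivity))
  refine (norm_sub_le _ _).trans ?_
  linarith

theorem hasDerivAt_energy (hX : IsTrajectory φ₁ φ₂ b X) {t : ℝ} (ht : 0 ≤ t) :
    HasDerivAt (fun t => reTrace n ((X t)ᴴ * X t)) (-2 * dissipation φ₁ φ₂ (X t)) t := by
  have := hasDerivAt_reTrace_pow (c := 1) (phiMat_isHermitian φ₁ φ₂ (X t))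
    ((hX.hasDerivAt t ht).congr_deriv (one_smul ℝ _).symm) 0
  simpa [dissipation] using this

theorem exists_tendsto_energy (hX : IsTrajectory φ₁ φ₂ b X) (hC : CondC0 φ₁ φ₂ 0 b) :
    ∃ l, Tendsto (fun t => reTrace n ((X t)ᴴ * X t)) atTop (𝓝 l) := by
  have hanti : AntitoneOn (fun t => reTrace n ((X t)ᴴ * X t)) (Ici 0) := by
    refine antitoneOn_of_hasDerivWithinAt_nonpos (convex_Ici 0)
      (fun t ht => (hX.hasDerivAt_energy ht).continuousAt.continuousWithinAt)
      (fun t ht => (hX.hasDerivAt_energy (interior_subset ht)).hasDerivWithinAt) fun t ht => ?_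
    have := dissipation_nonneg hC (hX.mem t (interior_subset ht))
    linarith
  have hanti' : Antitone fun t => reTrace n ((X (max t 0))ᴴ * X (max t 0)) := fun s t hst =>
    hanti (mem_Ici.2 (le_max_right s 0)) (mem_Ici.2 (le_max_right t 0)) (max_le_max_right 0 hst)
  have hbdd : BddBelow (range fun t => reTrace n ((X (max t 0))ᴴ * X (max t 0))) := by
    refine ⟨0, ?_⟩
    rintro _ ⟨t, rfl⟩
    simp only [reTrace_apply, ← frobenius_norm_sq_eq_trace]
    positivity
  refine ⟨_, (tendsto_atTop_ciInf hanti' hbdd).congr' ?_⟩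
  filter_upwards [eventually_ge_atTop 0] with t ht
  rw [max_eq_left ht]

/-- LaSalle's principle: the limit points of a trajectory are normal matrices. -/
theorem isStarNormal_of_tendsto (hX : IsTrajectory φ₁ φ₂ b X) (hb : 0 < b)
    (hC : CondCL φ₁ φ₂ 0 b) {t : ℕ → ℝ} (ht : Tendsto t atTop atTop)
    {N : Matrix (Fin n) (Fin n) ℂ} (hN : Tendsto (fun m => X (t m)) atTop (𝓝 N)) :
    N ∈ matIcc n 0 b ∧ IsStarNormal N := by
  have hNmem : N ∈ matIcc n 0 b := (isClosed_matIcc hb).mem_of_tendsto hN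
    ((ht.eventually_ge_atTop 0).mono fun m hm => hX.mem _ hm)
  refine ⟨hNmem, isStarNormal_of_re_trace_eq_zero hC.toCondC0 hNmem ?_⟩
  by_contra hne
  set d := dissipation φ₁ φ₂ N with hd
  have hd0 : 0 < d := lt_of_le_of_ne (dissipation_nonneg hC.toCondC0 hNmem) (Ne.symm hne)
  obtain ⟨δ, hδ, hball⟩ : ∃ δ > 0, ∀ Y ∈ matIcc n 0 b, ‖Y - N‖ < δ →
      d / 2 < dissipation φ₁ φ₂ Y := by
    have h1 := (hC.continuousOn_dissipation (n := n) hb N hNmem).eventually_const_lt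
      (half_lt_self hd0)
    obtain ⟨δ, hδ, h2⟩ := Metric.mem_nhdsWithin_iff.1 h1
    exact ⟨δ, hδ, fun Y hY hYN => h2 ⟨by rwa [Metric.mem_ball, dist_eq_norm], hY⟩⟩
  obtain ⟨C, hC0, hspeed⟩ := hX.exists_norm_sub_le hb hC
  -- At speed at most `C`, a trajectory starting within `δ / 2` of `N` stays within `δ` for time
  -- `τ`, losing energy at least `dτ`.
  set τ := δ / (2 * C) with hτ
  have hτ0 : 0 < τ := by positivity
  obtain ⟨l, hl⟩ := hX.exists_tendsto_energy hC.toCondC0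
  have hl1 := hl.comp ht
  have hl2 := hl.comp (tendsto_atTop_add_const_right _ τ ht)
  have hev : ∀ᶠ m in atTop, reTrace n ((X (t m + τ))ᴴ * X (t m + τ)) ≤
      reTrace n ((X (t m))ᴴ * X (t m)) - d * τ := by
    have hclose : ∀ᶠ m in atTop, ‖X (t m) - N‖ < δ / 2 := by
      have := Metric.tendsto_nhds.1 hN (δ / 2) (by positivity)
      simpa only [dist_eq_norm] using this
    filter_upwards [ht.eventually_ge_atTop 0, hclose] with m hm0 hm
    have hmono : AntitoneOn (fun s => reTrace n ((X s)ᴴ * X s) + d * s)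
        (Icc (t m) (t m + τ)) := by
      have hder : ∀ s ∈ Icc (t m) (t m + τ), HasDerivAt
          (fun s => reTrace n ((X s)ᴴ * X s) + d * s)
          (-2 * dissipation φ₁ φ₂ (X s) + d * 1) s := fun s hs =>
        (hX.hasDerivAt_energy (hm0.trans hs.1)).add ((hasDerivAt_id s).const_mul d)
      refine antitoneOn_of_hasDerivWithinAt_nonpos (convex_Icc _ _)
        (fun s hs => (hder s hs).continuousAt.continuousWithinAt)
        (fun s hs => (hder s (interior_subset hs)).hasDerivWithinAt) fun s hs => ?_
      have hs' := interior_subset hs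
      have hs0 : 0 ≤ s := hm0.trans hs'.1
      have h1 : ‖X s - X (t m)‖ ≤ δ / 2 := by
        refine (hspeed (t m) hm0 s hs0).trans ?_
        rw [abs_of_nonneg (sub_nonneg.2 hs'.1)]
        calc C * (s - t m) ≤ C * τ := by gcongr; linarith [hs'.2]
          _ = δ / 2 := by rw [hτ]; field_simp
      have h2 : ‖X s - N‖ < δ := by
        have := norm_add_le (X s - X (t m)) (X (t m) - N)
        rw [sub_add_sub_cancel] at this
        linarith
      have := hball _ (hX.mem s hs0) h2
      linarith
    have := hmono ⟨le_rfl, by linarith⟩ ⟨by linarith, le_rfl⟩ (by linarith : t m ≤ t m + τ)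
    simp only at this
    linarith
  -- The energies at `t m` and `t m + τ` have the same limit `l`, so this reads `l ≤ l - dτ`.
  have hfin := le_of_tendsto_of_tendsto hl2 (hl1.sub_const (d * τ)) hev
  have := mul_pos hd0 hτ0
  linarith

end IsTrajectory

/-! ### Polynomials along the flow -/

/-- The commutator with `S` is a derivation that kills scalars, so the Lax equation passes from `X`
to each polynomial in `X`. -/
theorem HasDerivAt.aeval_commutator {X : ℝ → Matrix (Fin n) (Fin n) ℂ} {t : ℝ}
    {S : Matrix (Fin n) (Fin n) ℂ} (h : HasDerivAt X (S * X t - X t * S) t)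
    (q : Polynomial ℂ) :
    HasDerivAt (fun t => Polynomial.aeval (X t) q)
      (S * Polynomial.aeval (X t) q - Polynomial.aeval (X t) q * S) t := by
  induction q using Polynomial.induction_on' with
  | add p q hp hq =>
    simp only [map_add]
    refine (hp.add hq).congr_deriv ?_
    noncomm_ring
  | monomial k c =>
    have hpow : HasDerivAt (fun t => X t ^ k) (S * X t ^ k - X t ^ k * S) t := by
      induction k with
      | zero =>
        simp only [pow_zero, mul_one, one_mul, sub_self]
        exact hasDerivAt_const t _
      | succ k ih =>
        simp only [pow_succ]
        refine (ih.mul h).congr_deriv ?_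
        noncomm_ring
    simp only [Polynomial.aeval_monomial]
    refine (hpow.const_mul (algebraMap ℂ (Matrix (Fin n) (Fin n) ℂ) c)).congr_deriv ?_
    rw [mul_sub, ← mul_assoc, ← mul_assoc, ← mul_assoc, Algebra.commutes c S]

/-- Polynomial relations are preserved along a trajectory. -/
theorem IsTrajectory.aeval_eq_zero {φ₁ φ₂ : ℝ → ℝ} {b : ℝ} {X : ℝ → Matrix (Fin n) (Fin n) ℂ}
    (hX : IsTrajectory φ₁ φ₂ b X) (hb : 0 < b) (hC : CondCL φ₁ φ₂ 0 b) {q : Polynomial ℂ}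
    (hq : Polynomial.aeval (X 0) q = 0) {t : ℝ} (ht : 0 ≤ t) : Polynomial.aeval (X t) q = 0 := by
  obtain ⟨M, hM, hbd⟩ := hC.exists_norm_phiMat_le (n := n) hb
  have hd := fun s (hs : 0 ≤ s) => (hX.hasDerivAt s hs).aeval_commutator q
  -- Grönwall: the commutator equation for `Z` is linear with `‖Z'‖ ≤ 2M‖Z‖`.
  refine eq_zero_of_abs_deriv_le_mul_abs_self_of_eq_zero_right (K := 2 * M) (a := 0) (b := t)
    (fun s hs => (hd s hs.1).continuousAt.continuousWithinAt)
    (fun s hs => (hd s hs.1).hasDerivWithinAt) hq (fun s hs => ?_) t ⟨ht, le_rfl⟩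
  set Z := Polynomial.aeval (X s) q
  have h1 := hbd _ (hX.mem s hs.1)
  have h3 : ‖phiMat φ₁ φ₂ (X s) * Z‖ ≤ M * ‖Z‖ :=
    (norm_mul_le _ _).trans (mul_le_mul_of_nonneg_right h1 (norm_nonneg _))
  have h4 : ‖Z * phiMat φ₁ φ₂ (X s)‖ ≤ ‖Z‖ * M :=
    (norm_mul_le _ _).trans (mul_le_mul_of_nonneg_left h1 (norm_nonneg _))
  refine (norm_sub_le _ _).trans ?_
  linarith

/-! ### Divided differences -/

/-- The divided difference of `φ` on `[0, b]`, extended by the derivative on the diagonal. -/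
noncomputable def dividedDiff (φ : ℝ → ℝ) (b x y : ℝ) : ℝ :=
  if x = y then derivWithin φ (Icc 0 b) x else (φ x - φ y) / (x - y)

theorem dividedDiff_mul_sub (φ : ℝ → ℝ) (b x y : ℝ) :
    dividedDiff φ b x y * (x - y) = φ x - φ y := by
  rw [dividedDiff]
  split_ifs with h
  · simp [h]
  · exact div_mul_cancel₀ _ (sub_ne_zero.2 h)

theorem dividedDiff_comm (φ : ℝ → ℝ) (b x y : ℝ) : dividedDiff φ b x y = dividedDiff φ b y x := by
  rw [dividedDiff, dividedDiff]
  by_cases h : x = y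
  · simp [h]
  · rw [if_neg h, if_neg (Ne.symm h), ← neg_sub (φ y), ← neg_sub y, neg_div_neg_eq]

/-- The mean value theorem for the divided difference. -/
theorem exists_dividedDiff_eq {φ : ℝ → ℝ} {b : ℝ} (hφ : ContDiffOn ℝ 1 φ (Icc 0 b))
    {x y : ℝ} (hx : x ∈ Icc 0 b) (hy : y ∈ Icc 0 b) :
    ∃ ξ ∈ Icc (min x y) (max x y), ξ ∈ Icc 0 b ∧
      dividedDiff φ b x y = derivWithin φ (Icc 0 b) ξ := by
  wlog hxy : x ≤ y generalizing x y
  · obtain ⟨ξ, h1, h2, h3⟩ := this hy hx (le_of_not_ge hxy)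
    exact ⟨ξ, by rwa [min_comm, max_comm], h2, by rw [dividedDiff_comm, h3]⟩
  rw [min_eq_left hxy, max_eq_right hxy]
  rcases hxy.eq_or_lt with rfl | hlt
  · exact ⟨x, ⟨le_rfl, le_rfl⟩, hx, by simp [dividedDiff]⟩
  have hsub : Icc x y ⊆ Icc 0 b := Icc_subset_Icc hx.1 hy.2
  have hnhds : ∀ z ∈ Ioo x y, Icc 0 b ∈ 𝓝 z := fun z hz =>
    Icc_mem_nhds (hx.1.trans_lt hz.1) (hz.2.trans_le hy.2)
  have hdiff := hφ.differentiableOn one_ne_zero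
  obtain ⟨ξ, hξ, he⟩ := exists_deriv_eq_slope φ hlt (hφ.continuousOn.mono hsub)
    fun z hz => ((hdiff z (hsub (Ioo_subset_Icc_self hz))).differentiableAt
      (hnhds z hz)).differentiableWithinAt
  refine ⟨ξ, Ioo_subset_Icc_self hξ, hsub (Ioo_subset_Icc_self hξ), ?_⟩
  rw [derivWithin_of_mem_nhds (hnhds ξ hξ), he, dividedDiff_comm, dividedDiff, if_neg hlt.ne']

theorem continuousOn_derivWithin_of_contDiffOn {φ : ℝ → ℝ} {b : ℝ} (hb : 0 < b)
    (hφ : ContDiffOn ℝ 1 φ (Icc 0 b)) : ContinuousOn (derivWithin φ (Icc 0 b)) (Icc 0 b) :=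
  hφ.continuousOn_derivWithin (uniqueDiffOn_Icc hb) le_rfl

theorem exists_abs_dividedDiff_le {φ : ℝ → ℝ} {b : ℝ} (hb : 0 < b)
    (hφ : ContDiffOn ℝ 1 φ (Icc 0 b)) :
    ∃ C, 0 ≤ C ∧ ∀ x ∈ Icc 0 b, ∀ y ∈ Icc 0 b, |dividedDiff φ b x y| ≤ C := by
  obtain ⟨C, hC⟩ := isCompact_Icc.exists_bound_of_continuousOn
    (continuousOn_derivWithin_of_contDiffOn hb hφ)
  refine ⟨C, (norm_nonneg _).trans (hC 0 ⟨le_rfl, hb.le⟩), fun x hx y hy => ?_⟩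
  obtain ⟨ξ, -, hξ, he⟩ := exists_dividedDiff_eq hφ hx hy
  rw [he]
  exact hC ξ hξ

/-- Off the diagonal this is continuity of the quotient. On it, the mean value points are squeezed
to the limit and the derivative is continuous. -/
theorem tendsto_dividedDiff {φ : ℝ → ℝ} {b : ℝ} (hb : 0 < b) (hφ : ContDiffOn ℝ 1 φ (Icc 0 b))
    {u v : ℕ → ℝ} (hu : ∀ m, u m ∈ Icc 0 b) (hv : ∀ m, v m ∈ Icc 0 b) {x y : ℝ}
    (hux : Tendsto u atTop (𝓝 x)) (hvy : Tendsto v atTop (𝓝 y)) :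
    Tendsto (fun m => dividedDiff φ b (u m) (v m)) atTop (𝓝 (dividedDiff φ b x y)) := by
  have hx : x ∈ Icc 0 b := isClosed_Icc.mem_of_tendsto hux (Eventually.of_forall hu)
  have hy : y ∈ Icc 0 b := isClosed_Icc.mem_of_tendsto hvy (Eventually.of_forall hv)
  have hwithin : ∀ {w : ℕ → ℝ} {z : ℝ}, (∀ m, w m ∈ Icc 0 b) → Tendsto w atTop (𝓝 z) →
      Tendsto w atTop (𝓝[Icc 0 b] z) := fun hw hwz =>
    tendsto_nhdsWithin_iff.2 ⟨hwz, Eventually.of_forall hw⟩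
  by_cases hxy : x = y
  · subst hxy
    choose ξ hξ hξb he using fun m => exists_dividedDiff_eq hφ (hu m) (hv m)
    have hξx : Tendsto ξ atTop (𝓝 x) := by
      have h1 : Tendsto (fun m => min (u m) (v m)) atTop (𝓝 x) := by
        simpa using hux.min hvy
      have h2 : Tendsto (fun m => max (u m) (v m)) atTop (𝓝 x) := by
        simpa using hux.max hvy
      exact tendsto_of_tendsto_of_tendsto_of_le_of_le h1 h2 (fun m => (hξ m).1)
        fun m => (hξ m).2
    simp only [he]
    rw [dividedDiff, if_pos rfl]
    exact (continuousOn_derivWithin_of_contDiffOn hb hφ x hx).tendsto.comp (hwithin hξb hξx)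
  · have hc := hφ.continuousOn
    have h1 : Tendsto (fun m => (φ (u m) - φ (v m)) / (u m - v m)) atTop
        (𝓝 ((φ x - φ y) / (x - y))) :=
      (((hc x hx).tendsto.comp (hwithin hu hux)).sub
        ((hc y hy).tendsto.comp (hwithin hv hvy))).div (hux.sub hvy) (sub_ne_zero.2 hxy)
    rw [dividedDiff, if_neg hxy]
    refine h1.congr' ?_
    have hne : ∀ᶠ m in atTop, u m - v m ≠ 0 := (hux.sub hvy).eventually_ne (sub_ne_zero.2 hxy)
    filter_upwards [hne] with m hm
    rw [dividedDiff, if_neg (sub_ne_zero.1 hm)]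

/-- Strict monotonicity settles `x ≠ y` and the derivative condition settles `x = y`. The origin is
excluded because both derivatives may vanish there. -/
theorem CondC1.dividedDiff_add_pos {φ₁ φ₂ : ℝ → ℝ} {b : ℝ} (hC : CondC1 φ₁ φ₂ 0 b) {x y : ℝ}
    (hx : x ∈ Icc 0 b) (hy : y ∈ Icc 0 b) (h0 : x ≠ 0 ∨ y ≠ 0) :
    0 < dividedDiff φ₁ b x y + dividedDiff φ₂ b x y := by
  by_cases hxy : x = y
  · subst hxy
    have hx0 : x ≠ 0 := h0.elim id id
    simp only [dividedDiff, if_true]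
    exact hC.deriv_pos x ⟨hx, hx0⟩
  · simp only [dividedDiff, if_neg hxy, ← add_div]
    have hm := hC.strictMonoOn_add
    rcases lt_or_gt_of_ne hxy with h | h
    · refine div_pos_of_neg_of_neg ?_ (sub_neg.2 h)
      have := hm hx hy h
      simp only at this
      linarith
    · refine div_pos ?_ (sub_pos.2 h)
      have := hm hy hx h
      simp only at this
      linarith

/-! ### Weighted sesquilinear forms -/

/-- The sesquilinear form `∑ g a b * conj (A a b) * B a b`. -/
noncomputable def weightedForm (g : Fin n → Fin n → ℝ) (A B : Matrix (Fin n) (Fin n) ℂ) : ℂ :=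
  ∑ a, ∑ b, (g a b : ℂ) * (star (A a b) * B a b)

/-- If `K` links only indices of equal weight, multiplication by `K` commutes with the Schur
multiplier, so its adjoint is multiplication by `Kᴴ`. -/
theorem weightedForm_mul_right {g : Fin n → Fin n → ℝ} {K : Matrix (Fin n) (Fin n) ℂ}
    (hg : ∀ a c b, K c b = 0 ∨ g a b = g a c) (A B : Matrix (Fin n) (Fin n) ℂ) :
    weightedForm g A (B * K) = weightedForm g (A * Kᴴ) B := by
  unfold weightedForm
  refine Finset.sum_congr rfl fun a _ => ?_
  simp only [mul_apply, conjTranspose_apply, star_sum, star_mul', star_star, Finset.mul_sum,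
    Finset.sum_mul]
  rw [Finset.sum_comm]
  refine Finset.sum_congr rfl fun c _ => Finset.sum_congr rfl fun b _ => ?_
  rcases hg a c b with h | h
  · simp [h]
  · rw [h]; ring

theorem weightedForm_mul_left {g : Fin n → Fin n → ℝ} {K : Matrix (Fin n) (Fin n) ℂ}
    (hg : ∀ a c b, K a c = 0 ∨ g a b = g c b) (A B : Matrix (Fin n) (Fin n) ℂ) :
    weightedForm g A (K * B) = weightedForm g (Kᴴ * A) B := by
  unfold weightedForm
  rw [Finset.sum_comm]
  conv_rhs => rw [Finset.sum_comm]
  refine Finset.sum_congr rfl fun b _ => ?_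
  simp only [mul_apply, conjTranspose_apply, star_sum, star_mul', star_star, Finset.mul_sum,
    Finset.sum_mul]
  rw [Finset.sum_comm]
  refine Finset.sum_congr rfl fun c _ => Finset.sum_congr rfl fun a _ => ?_
  rcases hg a c b with h | h
  · simp [h]
  · rw [h]; ring

theorem weightedForm_self (g : Fin n → Fin n → ℝ) (A : Matrix (Fin n) (Fin n) ℂ) :
    weightedForm g A A = ((∑ a, ∑ b, g a b * ‖A a b‖ ^ 2 : ℝ) : ℂ) := by
  unfold weightedForm
  push_cast
  refine Finset.sum_congr rfl fun a _ => Finset.sum_congr rfl fun b _ => ?_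
  rw [← Complex.conj_mul' (A a b)]
  rfl

theorem re_weightedForm (g : Fin n → Fin n → ℝ) (A B : Matrix (Fin n) (Fin n) ℂ) :
    (weightedForm g A B).re = ∑ a, ∑ b, g a b * (star (A a b) * B a b).re := by
  unfold weightedForm
  simp only [Complex.re_sum, Complex.re_ofReal_mul]

/-- Polarisation for two elements of equal form value; positivity of the weights plays no role. -/
theorem re_weightedForm_sub_right (g : Fin n → Fin n → ℝ) {A C : Matrix (Fin n) (Fin n) ℂ}
    (h : weightedForm g A A = weightedForm g C C) :
    (weightedForm g A (C - A)).re = -(1 / 2) * ∑ a, ∑ b, g a b * ‖(C - A) a b‖ ^ 2 := by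
  rw [weightedForm_self, weightedForm_self] at h
  have h' : ∑ a, ∑ b, g a b * ‖A a b‖ ^ 2 = ∑ a, ∑ b, g a b * ‖C a b‖ ^ 2 := by exact_mod_cast h
  have e : (weightedForm g A (C - A)).re = -(1 / 2) * ∑ a, ∑ b, g a b * ‖(C - A) a b‖ ^ 2 +
      (1 / 2) * (∑ a, ∑ b, g a b * ‖C a b‖ ^ 2 - ∑ a, ∑ b, g a b * ‖A a b‖ ^ 2) := by
    rw [re_weightedForm]
    simp only [Finset.mul_sum, ← Finset.sum_sub_distrib, ← Finset.sum_add_distrib]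
    refine Finset.sum_congr rfl fun a _ => Finset.sum_congr rfl fun b _ => ?_
    simp only [Matrix.sub_apply, ← Complex.normSq_eq_norm_sq, Complex.normSq_apply]
    simp
    ring
  rw [e, h']
  ring

theorem re_weightedForm_sub_left (g : Fin n → Fin n → ℝ) {A C : Matrix (Fin n) (Fin n) ℂ}
    (h : weightedForm g A A = weightedForm g C C) :
    (weightedForm g C (C - A)).re = (1 / 2) * ∑ a, ∑ b, g a b * ‖(C - A) a b‖ ^ 2 := by
  have h1 := re_weightedForm_sub_right g h.symm
  have h2 : weightedForm g C (A - C) = -weightedForm g C (C - A) := by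
    unfold weightedForm
    simp only [← Finset.sum_neg_distrib]
    refine Finset.sum_congr rfl fun a _ => Finset.sum_congr rfl fun b _ => ?_
    simp only [Matrix.sub_apply]
    ring
  have h3 : ∑ a, ∑ b, g a b * ‖(A - C) a b‖ ^ 2 = ∑ a, ∑ b, g a b * ‖(C - A) a b‖ ^ 2 := by
    refine Finset.sum_congr rfl fun a _ => Finset.sum_congr rfl fun b _ => ?_
    rw [Matrix.sub_apply, Matrix.sub_apply, norm_sub_rev]
  rw [h2, h3, Complex.neg_re] at h1
  linarith

/-- Schur multipliers attached to the spectral decomposition of a Hermitian matrix do not depend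
on the choice of the eigenbasis. -/
theorem weightedForm_basis_change {U V : Matrix (Fin n) (Fin n) ℂ} (hU : Uᴴ * U = 1)
    (hV : Vᴴ * V = 1) {α : Fin n → ℝ} (hUV : U * rdiag α * Uᴴ = V * rdiag α * Vᴴ)
    (h : ℝ → ℝ → ℝ) (A B : Matrix (Fin n) (Fin n) ℂ) :
    weightedForm (fun a b => h (α a) (α b)) (Vᴴ * A * V) (Vᴴ * B * V) =
      weightedForm (fun a b => h (α a) (α b)) (Uᴴ * A * U) (Uᴴ * B * U) := by
  have hU' := mul_eq_one_comm.1 hU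
  have hV' := mul_eq_one_comm.1 hV
  set O := Uᴴ * V with hO
  have hOO : O * Oᴴ = 1 := by
    rw [hO, conjTranspose_mul, conjTranspose_conjTranspose, mul_assoc, ← mul_assoc V, hV', one_mul,
      hU]
  have hcomm : rdiag α * O = O * rdiag α := by
    calc rdiag α * O = Uᴴ * (U * rdiag α * Uᴴ) * V := by
          rw [hO, ← mul_assoc, ← mul_assoc, ← mul_assoc, hU, one_mul, mul_assoc]
      _ = Uᴴ * V * rdiag α * (Vᴴ * V) := by rw [hUV]; simp only [mul_assoc]
      _ = _ := by rw [hV, mul_one]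
  have hloc : ∀ i a, O i a = 0 ∨ α i = α a := by
    intro i a
    have := congrFun (congrFun hcomm i) a
    rw [rdiag_mul_apply, mul_rdiag_apply, mul_comm (O i a), ← sub_eq_zero, ← sub_mul] at this
    rcases mul_eq_zero.1 this with h | h
    · right
      have : (α i : ℂ) = α a := sub_eq_zero.1 h
      exact_mod_cast this
    · exact Or.inl h
  have hconj : ∀ Z, Vᴴ * Z * V = Oᴴ * (Uᴴ * Z * U) * O := by
    intro Z
    calc Vᴴ * Z * V = Vᴴ * (U * Uᴴ) * Z * (U * Uᴴ) * V := by rw [hU', mul_one, mul_one]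
      _ = _ := by
        rw [hO, conjTranspose_mul, conjTranspose_conjTranspose]
        simp only [mul_assoc]
  rw [hconj A, hconj B]
  set A' := Uᴴ * A * U
  set B' := Uᴴ * B * U
  rw [weightedForm_mul_right (K := O), weightedForm_mul_left (K := Oᴴ)]
  · rw [conjTranspose_conjTranspose]
    have : O * (Oᴴ * A' * O * Oᴴ) = A' := by
      calc _ = (O * Oᴴ) * A' * (O * Oᴴ) := by simp only [mul_assoc]
        _ = A' := by rw [hOO, one_mul, mul_one]
    rw [this]
  · intro a c b
    rcases hloc c a with h0 | h0
    · left
      rw [conjTranspose_apply, h0, star_zero]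
    · right
      rw [h0]
  · intro a c b
    rcases hloc c b with h0 | h0
    · exact Or.inl h0
    · right
      rw [h0]

/-! ### The commutator with `φ(X)` as a form in `P - Pᴴ` -/

/-- The coefficient relating `[φ(|X|), P]` to `[Xᴴ, P - Pᴴ]` in singular bases. -/
noncomputable def commCoef (φ : ℝ → ℝ) (b x y : ℝ) : ℝ := dividedDiff φ b x y * (y / (x + y))

theorem abs_commCoef_le {φ : ℝ → ℝ} {b C x y : ℝ} (hx : 0 ≤ x) (hy : 0 ≤ y)
    (hC : |dividedDiff φ b x y| ≤ C) : |commCoef φ b x y| ≤ C := by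
  have h1 : |y / (x + y)| ≤ 1 := by
    rw [abs_of_nonneg (by positivity)]
    exact div_le_one_of_le₀ (by linarith) (by positivity)
  rw [commCoef, abs_mul]
  calc _ ≤ C * 1 := mul_le_mul hC h1 (abs_nonneg _) ((abs_nonneg _).trans hC)
    _ = C := mul_one C

theorem IsSVD.mul_right_basis {X V U : Matrix (Fin n) (Fin n) ℂ} {α : Fin n → ℝ}
    (h : IsSVD X V U α) : X * U = V * rdiag α := by
  rw [h.eq, mul_assoc, h.right, mul_one]

theorem IsSVD.left_basis_mul {X V U : Matrix (Fin n) (Fin n) ℂ} {α : Fin n → ℝ}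
    (h : IsSVD X V U α) : Vᴴ * X = rdiag α * Uᴴ := by
  rw [h.eq, ← mul_assoc, ← mul_assoc, h.left, one_mul]

/-- As `Pᴴ` commutes with `Xᴴ`, one has `[XᴴX, P] = [Xᴴ, P - Pᴴ] X`. In singular bases this says `(α
a² - α c²) p = y α c`, and multiplying `(α a - α c) p` by the divided difference gives the
coefficient. -/
theorem IsSVD.commutator_cfc_apply {φ : ℝ → ℝ} {b : ℝ} {X V U P : Matrix (Fin n) (Fin n) ℂ}
    {α : Fin n → ℝ} (h : IsSVD X V U α) (hP : X * P = P * X) (a c : Fin n) :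
    (Uᴴ * (cfc φ (matAbs X) * P - P * cfc φ (matAbs X)) * U) a c =
      commCoef φ b (α a) (α c) * (Uᴴ * (Xᴴ * (P - Pᴴ) - (P - Pᴴ) * Xᴴ) * V) a c := by
  have hconj : ∀ f : Fin n → ℝ, Uᴴ * ((U * rdiag f * Uᴴ) * P - P * (U * rdiag f * Uᴴ)) * U =
      rdiag f * (Uᴴ * P * U) - (Uᴴ * P * U) * rdiag f := by
    intro f
    calc _ = (Uᴴ * U) * rdiag f * (Uᴴ * P * U) - (Uᴴ * P * U) * rdiag f * (Uᴴ * U) := by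
          simp only [mul_sub, sub_mul, mul_assoc]
      _ = _ := by rw [h.right, one_mul, mul_one]
  have hPH : Pᴴ * Xᴴ = Xᴴ * Pᴴ := by rw [← conjTranspose_mul, hP, conjTranspose_mul]
  have hkey : Uᴴ * (Xᴴ * (P - Pᴴ) - (P - Pᴴ) * Xᴴ) * V * rdiag α =
      rdiag (fun i => α i ^ 2) * (Uᴴ * P * U) - (Uᴴ * P * U) * rdiag fun i => α i ^ 2 := by
    rw [← hconj, ← h.conjTranspose_mul_self, mul_assoc _ V, ← h.mul_right_basis]
    have e : Xᴴ * (P - Pᴴ) - (P - Pᴴ) * Xᴴ = Xᴴ * P - P * Xᴴ := by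
      rw [mul_sub, sub_mul, hPH]; abel
    have e2 : Xᴴ * X * P - P * (Xᴴ * X) = (Xᴴ * P - P * Xᴴ) * X := by
      rw [sub_mul, mul_assoc, hP]; simp only [mul_assoc]
    rw [e, e2]
    simp only [mul_assoc]
  have h1 := congrFun (congrFun hkey a) c
  rw [mul_rdiag_apply, Matrix.sub_apply, rdiag_mul_apply, mul_rdiag_apply] at h1
  rw [h.cfc_matAbs, hconj, Matrix.sub_apply, rdiag_mul_apply, mul_rdiag_apply]
  set y := (Uᴴ * (Xᴴ * (P - Pᴴ) - (P - Pᴴ) * Xᴴ) * V) a c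
  set p := (Uᴴ * P * U) a c
  have h2 := dividedDiff_mul_sub φ b (α a) (α c)
  have h2' : (φ (α a) : ℂ) - φ (α c) = dividedDiff φ b (α a) (α c) * (α a - α c) := by
    exact_mod_cast h2.symm
  have e3 : (φ (α a) : ℂ) * p - p * φ (α c) = ((φ (α a) : ℂ) - φ (α c)) * p := by ring
  rw [e3, h2', commCoef]
  have ha := h.nonneg a
  have hc := h.nonneg c
  -- When both singular values vanish, the left side is zero and the convention `0 / 0 = 0` makes
  -- the coefficient zero too.
  by_cases h0 : α a + α c = 0
  · have ha0 : α a = 0 := by linarith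
    have hc0 : α c = 0 := by linarith
    simp [ha0, hc0]
  · have h0' : (α a : ℂ) + α c ≠ 0 := by exact_mod_cast h0
    push_cast at h1 ⊢
    field_simp
    linear_combination (-(dividedDiff φ b (α a) (α c) : ℂ)) * h1

/-- The adjoint of the previous identity for `Xᴴ` and `Pᴴ`; this is what exchanges the arguments of
the coefficient. -/
theorem IsSVD.commutator_cfc_apply' {φ : ℝ → ℝ} {b : ℝ} {X V U P : Matrix (Fin n) (Fin n) ℂ}
    {α : Fin n → ℝ} (h : IsSVD X V U α) (hP : X * P = P * X) (a c : Fin n) :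
    (Vᴴ * (cfc φ (matAbs Xᴴ) * P - P * cfc φ (matAbs Xᴴ)) * V) a c =
      commCoef φ b (α c) (α a) * (Uᴴ * (Xᴴ * (P - Pᴴ) - (P - Pᴴ) * Xᴴ) * V) a c := by
  have hPH : Xᴴ * Pᴴ = Pᴴ * Xᴴ := by rw [← conjTranspose_mul, ← hP, conjTranspose_mul]
  have h1 := congrArg star (h.conjTranspose.commutator_cfc_apply (φ := φ) (b := b) hPH c a)
  have hsa : (cfc φ (matAbs Xᴴ))ᴴ = cfc φ (matAbs Xᴴ) := cfc_predicate φ (matAbs Xᴴ)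
  rw [star_mul', ← conjTranspose_apply, ← conjTranspose_apply] at h1
  simp only [conjTranspose_mul, conjTranspose_sub, conjTranspose_conjTranspose, hsa,
    RCLike.star_def, Complex.conj_ofReal] at h1
  have e1 : Vᴴ * (cfc φ (matAbs Xᴴ) * P - P * cfc φ (matAbs Xᴴ)) * V =
      -(Vᴴ * ((P * cfc φ (matAbs Xᴴ) - cfc φ (matAbs Xᴴ) * P) * V)) := by noncomm_ring
  have e2 : Uᴴ * (Xᴴ * (P - Pᴴ) - (P - Pᴴ) * Xᴴ) * V =
      -(Uᴴ * (((P - Pᴴ) * Xᴴ - Xᴴ * (P - Pᴴ)) * V)) := by noncomm_ring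
  rw [e1, e2, Matrix.neg_apply, Matrix.neg_apply, h1]
  ring

/-- The quadratic form governing the derivative of `‖P - Pᴴ‖ ^ 2` along the flow. -/
noncomputable def commForm (φ₁ φ₂ : ℝ → ℝ) (b : ℝ) (X V U : Matrix (Fin n) (Fin n) ℂ)
    (α : Fin n → ℝ) (E : Matrix (Fin n) (Fin n) ℂ) : ℂ :=
  weightedForm (fun a c => commCoef φ₁ b (α a) (α c)) (Uᴴ * E * U)
      (Uᴴ * (Xᴴ * E - E * Xᴴ) * V) -
    weightedForm (fun a c => commCoef φ₂ b (α c) (α a)) (Vᴴ * E * V)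
      (Uᴴ * (Xᴴ * E - E * Xᴴ) * V)

theorem trace_conjTranspose_mul_conj {U : Matrix (Fin n) (Fin n) ℂ} (hU : Uᴴ * U = 1)
    (A B : Matrix (Fin n) (Fin n) ℂ) :
    trace (Aᴴ * B) = ∑ a, ∑ c, star ((Uᴴ * A * U) a c) * (Uᴴ * B * U) a c := by
  have hU' := mul_eq_one_comm.1 hU
  rw [← trace_conjTranspose_mul_eq_sum]
  have : (Uᴴ * A * U)ᴴ * (Uᴴ * B * U) = Uᴴ * (Aᴴ * (U * Uᴴ) * B * U) := by
    simp only [conjTranspose_mul, conjTranspose_conjTranspose, mul_assoc]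
  rw [this, trace_mul_comm Uᴴ, mul_assoc _ U Uᴴ, hU', mul_one, mul_one]

/-- The point is that `P` enters the result only through its skew part, so a bound on the form
closes a differential inequality for `‖P - Pᴴ‖²`. -/
theorem IsSVD.trace_commutator_phiMat {φ₁ φ₂ : ℝ → ℝ} {b : ℝ}
    {X V U P : Matrix (Fin n) (Fin n) ℂ} {α : Fin n → ℝ} (h : IsSVD X V U α)
    (hP : X * P = P * X) :
    trace ((P - Pᴴ)ᴴ * (phiMat φ₁ φ₂ X * P - P * phiMat φ₁ φ₂ X)) =
      commForm φ₁ φ₂ b X V U α (P - Pᴴ) := by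
  have e : phiMat φ₁ φ₂ X * P - P * phiMat φ₁ φ₂ X =
      (cfc φ₁ (matAbs X) * P - P * cfc φ₁ (matAbs X)) -
        (cfc φ₂ (matAbs Xᴴ) * P - P * cfc φ₂ (matAbs Xᴴ)) := by
    rw [phiMat]; noncomm_ring
  rw [e, mul_sub, trace_sub, trace_conjTranspose_mul_conj h.right,
    trace_conjTranspose_mul_conj h.left, commForm, weightedForm, weightedForm]
  congr 1
  · refine Finset.sum_congr rfl fun a _ => Finset.sum_congr rfl fun c _ => ?_
    rw [h.commutator_cfc_apply (b := b) hP]; ring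
  · refine Finset.sum_congr rfl fun a _ => Finset.sum_congr rfl fun c _ => ?_
    rw [h.commutator_cfc_apply' (b := b) hP]; ring

theorem norm_le_of_entry_le {A B : Matrix (Fin n) (Fin n) ℂ} {C : ℝ} (hC : 0 ≤ C)
    (h : ∀ a c, ‖A a c‖ ≤ C * ‖B a c‖) : ‖A‖ ≤ C * ‖B‖ := by
  refine (sq_le_sq₀ (norm_nonneg _) (by positivity)).1 ?_
  rw [mul_pow, frobenius_norm_sq, frobenius_norm_sq]
  simp only [Finset.mul_sum]
  refine Finset.sum_le_sum fun a _ => Finset.sum_le_sum fun c _ => ?_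
  rw [← mul_pow]
  exact pow_le_pow_left₀ (norm_nonneg _) (h a c) 2

theorem norm_unitary_conj {U V : Matrix (Fin n) (Fin n) ℂ} (hU : Uᴴ * U = 1) (hV : Vᴴ * V = 1)
    (A : Matrix (Fin n) (Fin n) ℂ) : ‖Uᴴ * A * V‖ = ‖A‖ := by
  rw [frobenius_norm_mul_unitary hV, frobenius_norm_unitary_mul (conjTranspose_isometry hU)]

/-- For `P` commuting with `X`, the commutator `[φ(X), P]` is controlled by `P - Pᴴ`. -/
theorem CondC1.exists_norm_commutator_le {φ₁ φ₂ : ℝ → ℝ} {b : ℝ} (hb : 0 < b)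
    (hC : CondC1 φ₁ φ₂ 0 b) :
    ∃ C, 0 ≤ C ∧ ∀ X P : Matrix (Fin n) (Fin n) ℂ, X ∈ matIcc n 0 b → X * P = P * X →
      ‖phiMat φ₁ φ₂ X * P - P * phiMat φ₁ φ₂ X‖ ≤ C * ‖P - Pᴴ‖ := by
  obtain ⟨C₁, h₁0, h₁⟩ := exists_abs_dividedDiff_le hb hC.contDiffOn₁
  obtain ⟨C₂, h₂0, h₂⟩ := exists_abs_dividedDiff_le hb hC.contDiffOn₂
  refine ⟨(C₁ + C₂) * (2 * (n * b)), by positivity, fun X P hX hP => ?_⟩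
  obtain ⟨V, U, α, h⟩ := exists_isSVD X
  have hα := (h.mem_matIcc_iff 0 b).1 hX
  set Y := Xᴴ * (P - Pᴴ) - (P - Pᴴ) * Xᴴ with hY
  have hYn : ‖Y‖ ≤ 2 * (n * b) * ‖P - Pᴴ‖ := by
    have hXn : ‖Xᴴ‖ ≤ n * b := by
      rw [frobenius_norm_conjTranspose]; exact norm_le_of_mem_matIcc hX
    have e1 : ‖Xᴴ * (P - Pᴴ)‖ ≤ n * b * ‖P - Pᴴ‖ :=
      (norm_mul_le _ _).trans (mul_le_mul_of_nonneg_right hXn (norm_nonneg _))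
    have e2 : ‖(P - Pᴴ) * Xᴴ‖ ≤ ‖P - Pᴴ‖ * (n * b) :=
      (norm_mul_le _ _).trans (mul_le_mul_of_nonneg_left hXn (norm_nonneg _))
    refine (norm_sub_le _ _).trans ?_
    linarith
  have b1 : ‖cfc φ₁ (matAbs X) * P - P * cfc φ₁ (matAbs X)‖ ≤ C₁ * ‖Y‖ := by
    rw [← norm_unitary_conj h.right h.right, ← norm_unitary_conj h.right h.left Y]
    refine norm_le_of_entry_le h₁0 fun a c => ?_
    rw [h.commutator_cfc_apply (b := b) hP, norm_mul, Complex.norm_real]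
    exact mul_le_mul_of_nonneg_right
      (abs_commCoef_le (hα a).1 (hα c).1 (h₁ _ (hα a) _ (hα c))) (norm_nonneg _)
  have b2 : ‖cfc φ₂ (matAbs Xᴴ) * P - P * cfc φ₂ (matAbs Xᴴ)‖ ≤ C₂ * ‖Y‖ := by
    rw [← norm_unitary_conj h.left h.left, ← norm_unitary_conj h.right h.left Y]
    refine norm_le_of_entry_le h₂0 fun a c => ?_
    rw [h.commutator_cfc_apply' (b := b) hP, norm_mul, Complex.norm_real]
    exact mul_le_mul_of_nonneg_right
      (abs_commCoef_le (hα c).1 (hα a).1 (h₂ _ (hα c) _ (hα a))) (norm_nonneg _)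
  have e : phiMat φ₁ φ₂ X * P - P * phiMat φ₁ φ₂ X =
      (cfc φ₁ (matAbs X) * P - P * cfc φ₁ (matAbs X)) -
        (cfc φ₂ (matAbs Xᴴ) * P - P * cfc φ₂ (matAbs Xᴴ)) := by
    rw [phiMat]; noncomm_ring
  rw [e]
  calc _ ≤ C₁ * ‖Y‖ + C₂ * ‖Y‖ := (norm_sub_le _ _).trans (add_le_add b1 b2)
    _ = (C₁ + C₂) * ‖Y‖ := by ring
    _ ≤ (C₁ + C₂) * (2 * (n * b) * ‖P - Pᴴ‖) := by gcongr
    _ = _ := by ring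

theorem IsSVD.abs_eq_of_normal {N V U : Matrix (Fin n) (Fin n) ℂ} {α : Fin n → ℝ}
    (h : IsSVD N V U α) (hN : Nᴴ * N = N * Nᴴ) : U * rdiag α * Uᴴ = V * rdiag α * Vᴴ := by
  rw [← h.matAbs_eq, ← h.conjTranspose.matAbs_eq, matAbs, matAbs, conjTranspose_conjTranspose, hN]

/-- At a normal matrix the quadratic form is nonpositive on skew-Hermitian matrices, and vanishes
only on those commuting with the matrix. -/
theorem IsSVD.commute_of_commForm_nonneg {φ₁ φ₂ : ℝ → ℝ} {b : ℝ} (hC : CondC1 φ₁ φ₂ 0 b)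
    {N V U E : Matrix (Fin n) (Fin n) ℂ} {α : Fin n → ℝ} (h : IsSVD N V U α)
    (hα : ∀ i, α i ∈ Icc 0 b) (hN : Nᴴ * N = N * Nᴴ) (hE : Eᴴ = -E)
    (h0 : 0 ≤ (commForm φ₁ φ₂ b N V U α E).re) : N * E = E * N := by
  have hU' := mul_eq_one_comm.1 h.right
  set K := Uᴴ * N * U with hK
  set F := Uᴴ * E * U with hF
  have hconj : ∀ A B, (Uᴴ * A * U) * (Uᴴ * B * U) = Uᴴ * (A * B) * U := by
    intro A B
    calc _ = Uᴴ * A * (U * Uᴴ) * B * U := by simp only [mul_assoc]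
      _ = _ := by rw [hU', mul_one]; simp only [mul_assoc]
  have hKH : Kᴴ = Uᴴ * Nᴴ * U := by
    simp only [hK, conjTranspose_mul, conjTranspose_conjTranspose, mul_assoc]
  have hFH : Fᴴ = -F := by
    simp only [hF, conjTranspose_mul, conjTranspose_conjTranspose, hE, mul_assoc, neg_mul,
      mul_neg]
  have hKK : Kᴴ * K = rdiag fun i => α i ^ 2 := by
    rw [hKH, hK, hconj, h.conjTranspose_mul_self]
    calc _ = (Uᴴ * U) * (rdiag fun i => α i ^ 2) * (Uᴴ * U) := by simp only [mul_assoc]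
      _ = _ := by rw [h.right, one_mul, mul_one]
  have hKK' : K * Kᴴ = rdiag fun i => α i ^ 2 := by
    rw [← hKK, hKH, hK, hconj, hconj, hN]
  -- `K` is `N` in the basis `U`. By normality it commutes with `|N|²`, so it preserves the level
  -- sets of `α`.
  have hloc : ∀ a c, K a c = 0 ∨ α a = α c := by
    intro a c
    have : (rdiag fun i => α i ^ 2) * K = K * rdiag fun i => α i ^ 2 := by
      nth_rewrite 1 [← hKK']
      rw [← hKK, mul_assoc]
    have := congrFun (congrFun this a) c
    rw [rdiag_mul_apply, mul_rdiag_apply, mul_comm (K a c), ← sub_eq_zero, ← sub_mul] at this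
    rcases mul_eq_zero.1 this with h1 | h1
    · right
      have h2 : α a ^ 2 = α c ^ 2 := by
        have : ((α a ^ 2 : ℝ) : ℂ) = ((α c ^ 2 : ℝ) : ℂ) := sub_eq_zero.1 h1
        exact_mod_cast this
      exact (sq_eq_sq₀ (h.nonneg a) (h.nonneg c)).1 h2
    · exact Or.inl h1
  set A := F * Kᴴ with hA
  set C := Kᴴ * F with hC'
  set G := C - A with hG
  have hGconj : Uᴴ * (Nᴴ * E - E * Nᴴ) * U = G := by
    rw [hG, hC', hA, hKH, hF, hconj, hconj]
    noncomm_ring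
  -- Removing the factor `y` from `commCoef` leaves a symmetric kernel. The missing singular value
  -- is returned by `NU = V diag α` or `VᴴN = diag α Uᴴ`.
  set γ : (ℝ → ℝ) → ℝ → ℝ → ℝ := fun φ x y => dividedDiff φ b x y / (x + y) with hγ
  have hγc : ∀ φ x y, γ φ x y = γ φ y x := fun φ x y => by
    simp only [hγ]
    rw [dividedDiff_comm, add_comm]
  set g : (ℝ → ℝ) → Fin n → Fin n → ℝ := fun φ a c => γ φ (α a) (α c) with hg
  have hright : ∀ φ A B, weightedForm (g φ) A (B * K) = weightedForm (g φ) (A * Kᴴ) B := by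
    intro φ A B
    refine weightedForm_mul_right (fun a c d => ?_) A B
    rcases hloc c d with h1 | h1
    · exact Or.inl h1
    · right; simp only [hg, h1]
  have hleft : ∀ φ A B, weightedForm (g φ) A (K * B) = weightedForm (g φ) (Kᴴ * A) B := by
    intro φ A B
    refine weightedForm_mul_left (fun a c d => ?_) A B
    rcases hloc a c with h1 | h1
    · exact Or.inl h1
    · right; simp only [hg, h1]
  have first : weightedForm (fun a c => commCoef φ₁ b (α a) (α c)) (Uᴴ * E * U)
      (Uᴴ * (Nᴴ * E - E * Nᴴ) * V) = weightedForm (g φ₁) A G := by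
    rw [hA, ← hright, ← hGconj]
    have e : Uᴴ * (Nᴴ * E - E * Nᴴ) * U * K = Uᴴ * (Nᴴ * E - E * Nᴴ) * V * rdiag α := by
      rw [hK, hconj, mul_assoc _ V, ← h.mul_right_basis]
      simp only [mul_assoc]
    rw [e]
    unfold weightedForm
    refine Finset.sum_congr rfl fun a _ => Finset.sum_congr rfl fun c _ => ?_
    rw [mul_rdiag_apply]
    simp only [commCoef, hg, hγ, hF]
    push_cast
    ring
  have second : weightedForm (fun a c => commCoef φ₂ b (α c) (α a)) (Vᴴ * E * V)
      (Uᴴ * (Nᴴ * E - E * Nᴴ) * V) = weightedForm (g φ₂) C G := by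
    have e : Vᴴ * (N * (Nᴴ * E - E * Nᴴ)) * V = rdiag α * (Uᴴ * (Nᴴ * E - E * Nᴴ) * V) := by
      rw [← mul_assoc, h.left_basis_mul]
      simp only [mul_assoc]
    have e1 : weightedForm (fun a c => commCoef φ₂ b (α c) (α a)) (Vᴴ * E * V)
        (Uᴴ * (Nᴴ * E - E * Nᴴ) * V) =
        weightedForm (g φ₂) (Vᴴ * E * V) (Vᴴ * (N * (Nᴴ * E - E * Nᴴ)) * V) := by
      rw [e]
      unfold weightedForm
      refine Finset.sum_congr rfl fun a _ => Finset.sum_congr rfl fun c _ => ?_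
      rw [rdiag_mul_apply]
      simp only [commCoef, hg, hγ]
      rw [dividedDiff_comm φ₂ b (α c), add_comm (α c)]
      push_cast
      ring
    -- For normal `N` both `U` and `V` diagonalise `|N|`, so this term may be moved from the basis
    -- `V` to `U`.
    rw [e1, weightedForm_basis_change h.right h.left (h.abs_eq_of_normal hN) (γ φ₂), ← hconj,
      hGconj, ← hF, ← hK, hC']
    exact hleft φ₂ _ _
  -- Skewness of `F` and symmetry of the kernel equate the two values. Polarisation then turns the
  -- whole form into `-(1/2) ∑ (g φ₁ + g φ₂) ‖G‖²`.
  have hnorm : ∀ φ, weightedForm (g φ) A A = weightedForm (g φ) C C := by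
    intro φ
    have e1 : weightedForm (g φ) A A = weightedForm (g φ) F (F * rdiag fun i => α i ^ 2) := by
      rw [← hKK, ← mul_assoc, hright]
    have e2 : weightedForm (g φ) C C =
        weightedForm (g φ) F ((rdiag fun i => α i ^ 2) * F) := by
      rw [← hKK', mul_assoc, hleft]
    rw [e1, e2]
    unfold weightedForm
    rw [Finset.sum_comm]
    refine Finset.sum_congr rfl fun a _ => Finset.sum_congr rfl fun c _ => ?_
    rw [rdiag_mul_apply, mul_rdiag_apply]
    have f1 : F c a = -star (F a c) := by
      rw [← conjTranspose_apply, hFH, Matrix.neg_apply, neg_neg]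
    rw [f1]
    simp only [star_neg, star_star, hg]
    rw [hγc φ (α c)]
    ring
  rw [commForm, first, second, Complex.sub_re, re_weightedForm_sub_right _ (hnorm φ₁),
    re_weightedForm_sub_left _ (hnorm φ₂)] at h0
  have hpos : ∀ a c, 0 ≤ (g φ₁ a c + g φ₂ a c) * ‖G a c‖ ^ 2 := by
    intro a c
    refine mul_nonneg ?_ (by positivity)
    simp only [hg, hγ, ← add_div]
    by_cases hz : α a ≠ 0 ∨ α c ≠ 0
    · exact div_nonneg (hC.dividedDiff_add_pos (hα a) (hα c) hz).le
        (add_nonneg (h.nonneg a) (h.nonneg c))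
    · push Not at hz
      simp [hz.1, hz.2]
  have hsum : ∑ a, ∑ c, (g φ₁ a c + g φ₂ a c) * ‖G a c‖ ^ 2 = 0 := by
    refine le_antisymm ?_ (Finset.sum_nonneg fun a _ => Finset.sum_nonneg fun c _ => hpos a c)
    simp only [add_mul, Finset.sum_add_distrib]
    linarith
  have hG0 : G = 0 := by
    ext a c
    have t1 := (Finset.sum_eq_zero_iff_of_nonneg
      (fun a _ => Finset.sum_nonneg fun c _ => hpos a c)).1 hsum a (Finset.mem_univ a)
    have t2 := (Finset.sum_eq_zero_iff_of_nonneg (fun c _ => hpos a c)).1 t1 c (Finset.mem_univ c)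
    by_cases hz : α a ≠ 0 ∨ α c ≠ 0
    · have p1 := hC.dividedDiff_add_pos (hα a) (hα c) hz
      have p2 : 0 < α a + α c := by
        rcases hz with hz | hz
        · exact add_pos_of_pos_of_nonneg (lt_of_le_of_ne (h.nonneg a) hz.symm) (h.nonneg c)
        · exact add_pos_of_nonneg_of_pos (h.nonneg a) (lt_of_le_of_ne (h.nonneg c) hz.symm)
      have p3 : 0 < g φ₁ a c + g φ₂ a c := by
        simp only [hg, hγ, ← add_div]
        exact div_pos p1 p2
      have := (mul_eq_zero.1 t2).resolve_left p3.ne'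
      exact norm_eq_zero.1 (sq_eq_zero_iff.1 this)
    · push Not at hz
      -- The weight gives no information at two zero singular values; there the entry of `G`
      -- vanishes since `K` has zero column `a` and zero row `c`.
      have z1 : ∀ i, K i a = 0 := col_eq_zero_of_gram_eq_zero (by simp [hKK, rdiag, hz.1])
      have z2 : ∀ i, K c i = 0 := fun i => by
        have := col_eq_zero_of_gram_eq_zero (M := Kᴴ) (d := c)
          (by simp [hKK', rdiag, hz.2]) i
        rwa [conjTranspose_apply, star_eq_zero] at this
      rw [hG, hC', hA, Matrix.sub_apply, mul_apply, mul_apply]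
      simp [z1, z2]
  have hcomm : Nᴴ * E - E * Nᴴ = 0 := by
    have : U * (Uᴴ * (Nᴴ * E - E * Nᴴ) * U) * Uᴴ = 0 := by rw [hGconj, hG0]; simp
    calc Nᴴ * E - E * Nᴴ = (U * Uᴴ) * (Nᴴ * E - E * Nᴴ) * (U * Uᴴ) := by
          rw [hU', one_mul, mul_one]
      _ = U * (Uᴴ * (Nᴴ * E - E * Nᴴ) * U) * Uᴴ := by simp only [mul_assoc]
      _ = 0 := this
  have := congrArg star (sub_eq_zero.1 hcomm)
  simp only [star_eq_conjTranspose] at this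
  rw [conjTranspose_mul, conjTranspose_mul, conjTranspose_conjTranspose, hE, neg_mul, mul_neg,
    neg_inj] at this
  exact this.symm

/-! ### Spectral idempotents of normal matrices -/

theorem aeval_mul_comm_of_comm {N M : Matrix (Fin n) (Fin n) ℂ} (h : N * M = M * N)
    (q : Polynomial ℂ) : Polynomial.aeval N q * M = M * Polynomial.aeval N q := by
  induction q using Polynomial.induction_on' with
  | add p q hp hq => rw [map_add, add_mul, mul_add, hp, hq]
  | monomial k c =>
    have hk : N ^ k * M = M * N ^ k := Commute.pow_left h k
    rw [Polynomial.aeval_monomial, mul_assoc, hk, ← mul_assoc, ← mul_assoc, Algebra.commutes c M]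

theorem aeval_normal {N : Matrix (Fin n) (Fin n) ℂ} (hN : Nᴴ * N = N * Nᴴ) (q : Polynomial ℂ) :
    (Polynomial.aeval N q)ᴴ * Polynomial.aeval N q =
      Polynomial.aeval N q * (Polynomial.aeval N q)ᴴ := by
  have h1 := aeval_mul_comm_of_comm hN.symm q
  have h2 := congrArg star h1
  simp only [star_eq_conjTranspose, conjTranspose_mul, conjTranspose_conjTranspose] at h2
  exact (aeval_mul_comm_of_comm h2 q).symm

/-- The Gram matrix of `Q - QᴴQ` is zero, so `Q` equals the Hermitian matrix `QᴴQ`. -/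
theorem isHermitian_of_normal_idempotent {Q : Matrix (Fin n) (Fin n) ℂ} (hQ : Q * Q = Q)
    (hN : Qᴴ * Q = Q * Qᴴ) : Qᴴ = Q := by
  have hQ' : Qᴴ * Qᴴ = Qᴴ := by rw [← conjTranspose_mul, hQ]
  have h1 : (Q - Qᴴ * Q)ᴴ * (Q - Qᴴ * Q) = 0 := by
    have e : (Q - Qᴴ * Q)ᴴ = Qᴴ - Qᴴ * Q := by
      rw [conjTranspose_sub, conjTranspose_mul, conjTranspose_conjTranspose]
    have f1 : Qᴴ * (Qᴴ * Q) = Qᴴ * Q := by rw [← mul_assoc, hQ']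
    have f2 : Qᴴ * Q * Q = Qᴴ * Q := by rw [mul_assoc, hQ]
    have f3 : Qᴴ * Q * (Qᴴ * Q) = Qᴴ * Q := by
      rw [mul_assoc, ← mul_assoc Q, ← hN, mul_assoc Qᴴ, hQ, ← mul_assoc, hQ']
    rw [e, sub_mul, mul_sub, mul_sub, f1, f2, f3]
    simp
  have h2 := sub_eq_zero.1 (conjTranspose_mul_self_eq_zero.1 h1)
  calc Qᴴ = (Qᴴ * Q)ᴴ := by conv_lhs => rw [h2]
    _ = Qᴴ * Q := by rw [conjTranspose_mul, conjTranspose_conjTranspose]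
    _ = Q := h2.symm

/-- Writing `q = q₁ X + q(0)` shows that `q(N)` acts on kernel vectors of `N` by the scalar `q(0)`.
-/
theorem aeval_mul_apply_of_col_eq_zero {N W : Matrix (Fin n) (Fin n) ℂ} {a : Fin n}
    (h : ∀ i, (N * W) i a = 0) (q : Polynomial ℂ) (i : Fin n) :
    (Polynomial.aeval N q * W) i a = q.eval 0 * W i a := by
  conv_lhs => rw [← q.divX_mul_X_add]
  rw [map_add, map_mul, Polynomial.aeval_X, Polynomial.aeval_C, add_mul, mul_assoc,
    Matrix.add_apply, mul_apply]
  simp only [h, mul_zero, Finset.sum_const_zero, zero_add]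
  rw [Polynomial.coeff_zero_eq_eval_zero, ← Algebra.smul_def, Matrix.smul_apply, smul_eq_mul]

/-- If `E` is off-diagonal for the spectral projection `Q = q(N)`, its compression to the kernel
of `N` vanishes. -/
theorem compression_ker_eq_zero {N E W : Matrix (Fin n) (Fin n) ℂ} {q : Polynomial ℂ}
    (hW : Wᴴ * W = 1) {a c : Fin n} (ha : ∀ i, (N * W) i a = 0) (hc : ∀ i, (N * W) i c = 0)
    (hQ : Polynomial.aeval N q * Polynomial.aeval N q = Polynomial.aeval N q)
    (hQH : (Polynomial.aeval N q)ᴴ = Polynomial.aeval N q)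
    (hE : E * Polynomial.aeval N q + Polynomial.aeval N q * E = E) :
    (Wᴴ * E * W) a c = 0 := by
  set Q := Polynomial.aeval N q with hQdef
  set z := q.eval 0 with hz
  have hQa := aeval_mul_apply_of_col_eq_zero ha q
  have hQc := aeval_mul_apply_of_col_eq_zero hc q
  have hzz : z * z = z := by
    have h1 : ∀ i, z * z * W i c = z * W i c := by
      intro i
      have := aeval_mul_apply_of_col_eq_zero hc (q * q) i
      rw [map_mul, ← hQdef, hQ, hQc i, Polynomial.eval_mul] at this
      exact this.symm
    have hex : ∃ i, W i c ≠ 0 := by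
      by_contra hcon
      push Not at hcon
      have := congrFun (congrFun hW c) c
      rw [mul_apply, one_apply_eq] at this
      simp [hcon] at this
    obtain ⟨i, hi⟩ := hex
    exact mul_right_cancel₀ hi (h1 i)
  have e1 : (Wᴴ * (E * Q) * W) a c = z * (Wᴴ * E * W) a c := by
    have : Wᴴ * (E * Q) * W = (Wᴴ * E) * (Q * W) := by simp only [mul_assoc]
    rw [this, mul_apply, mul_apply, Finset.mul_sum]
    refine Finset.sum_congr rfl fun i _ => ?_
    rw [hQc i]; ring
  have e2 : (Wᴴ * (Q * E) * W) a c = star z * (Wᴴ * E * W) a c := by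
    have : Wᴴ * (Q * E) * W = (Q * W)ᴴ * (E * W) := by
      rw [conjTranspose_mul, hQH]; simp only [mul_assoc]
    rw [this, mul_assoc Wᴴ, mul_apply, mul_apply, Finset.mul_sum]
    refine Finset.sum_congr rfl fun i _ => ?_
    rw [conjTranspose_apply, hQa i, conjTranspose_apply, star_mul']
    ring
  have e3 : (Wᴴ * E * W) a c = (z + star z) * (Wᴴ * E * W) a c := by
    rw [add_mul, ← e1, ← e2, ← Matrix.add_apply, ← add_mul, ← mul_add, hE]
  -- The off-diagonal relation multiplies the compression by `z + star z`, which is 0 or 2 and never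
  -- 1.
  have hz01 : z = 0 ∨ z = 1 := by
    have : z * (z - 1) = 0 := by linear_combination hzz
    exact (mul_eq_zero.1 this).imp id sub_eq_zero.1
  rcases hz01 with h | h
  · simpa [h] using e3
  · rw [h, star_one] at e3
    linear_combination -e3

/-! ### The compactness argument for a negative rate -/

/-- At the origin `y / (x + y)` has no limit and the coefficient is only bounded, so the other
factor must tend to zero there. -/
theorem tendsto_commCoef_mul {φ : ℝ → ℝ} {b : ℝ} (hb : 0 < b) (hφ : ContDiffOn ℝ 1 φ (Icc 0 b))
    {u v : ℕ → ℝ} (hu : ∀ m, u m ∈ Icc 0 b) (hv : ∀ m, v m ∈ Icc 0 b) {x y : ℝ}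
    (hux : Tendsto u atTop (𝓝 x)) (hvy : Tendsto v atTop (𝓝 y)) {w : ℕ → ℂ} {z : ℂ}
    (hw : Tendsto w atTop (𝓝 z)) (hz : x = 0 → y = 0 → z = 0) :
    Tendsto (fun m => (commCoef φ b (u m) (v m) : ℂ) * w m) atTop
      (𝓝 ((commCoef φ b x y : ℂ) * z)) := by
  have hx : x ∈ Icc 0 b := isClosed_Icc.mem_of_tendsto hux (Eventually.of_forall hu)
  have hy : y ∈ Icc 0 b := isClosed_Icc.mem_of_tendsto hvy (Eventually.of_forall hv)
  by_cases h0 : x + y = 0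
  · have hx0 : x = 0 := by linarith [hx.1, hy.1]
    have hy0 : y = 0 := by linarith [hx.1, hy.1]
    rw [hz hx0 hy0] at hw
    rw [hz hx0 hy0, mul_zero]
    obtain ⟨C, hC0, hC⟩ := exists_abs_dividedDiff_le hb hφ
    have hw' : Tendsto (fun m => C * ‖w m‖) atTop (𝓝 0) := by
      simpa using hw.norm.const_mul C
    refine squeeze_zero_norm (fun m => ?_) hw'
    rw [norm_mul, Complex.norm_real]
    exact mul_le_mul_of_nonneg_right
      (abs_commCoef_le (hu m).1 (hv m).1 (hC _ (hu m) _ (hv m))) (norm_nonneg _)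
  · refine Tendsto.mul ?_ hw
    refine (Complex.continuous_ofReal.tendsto _).comp ?_
    exact (tendsto_dividedDiff hb hφ hu hv hux hvy).mul (hvy.div (hux.add hvy) h0)

theorem tendsto_weightedForm {g : ℕ → Fin n → Fin n → ℝ} {g' : Fin n → Fin n → ℝ}
    {A B : ℕ → Matrix (Fin n) (Fin n) ℂ} {A' B' : Matrix (Fin n) (Fin n) ℂ}
    (h : ∀ a c, Tendsto (fun m => (g m a c : ℂ) * (star (A m a c) * B m a c)) atTop
      (𝓝 ((g' a c : ℂ) * (star (A' a c) * B' a c)))) :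
    Tendsto (fun m => weightedForm (g m) (A m) (B m)) atTop (𝓝 (weightedForm g' A' B')) :=
  tendsto_finsetSum _ fun a _ => tendsto_finsetSum _ fun c _ => h a c

theorem weightedForm_smul (g : Fin n → Fin n → ℝ) (r : ℝ) (A B : Matrix (Fin n) (Fin n) ℂ) :
    weightedForm g (r • A) (r • B) = ((r ^ 2 : ℝ) : ℂ) * weightedForm g A B := by
  unfold weightedForm
  simp only [Finset.mul_sum, Matrix.smul_apply, Complex.real_smul]
  refine Finset.sum_congr rfl fun a _ => Finset.sum_congr rfl fun c _ => ?_
  simp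
  ring

theorem commForm_smul (φ₁ φ₂ : ℝ → ℝ) (b : ℝ) (X V U : Matrix (Fin n) (Fin n) ℂ)
    (α : Fin n → ℝ) (r : ℝ) (E : Matrix (Fin n) (Fin n) ℂ) :
    commForm φ₁ φ₂ b X V U α (r • E) = ((r ^ 2 : ℝ) : ℂ) * commForm φ₁ φ₂ b X V U α E := by
  unfold commForm
  simp only [mul_smul_comm, smul_mul_assoc, ← smul_sub, weightedForm_smul]
  ring

theorem norm_le_of_isometry {U : Matrix (Fin n) (Fin n) ℂ} (hU : Uᴴ * U = 1) : ‖U‖ ≤ n := by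
  have h1 : (1 : Matrix (Fin n) (Fin n) ℂ) = rdiag fun _ => 1 := by simp [rdiag]
  calc ‖U‖ = ‖(1 : Matrix (Fin n) (Fin n) ℂ)‖ := by
        rw [← frobenius_norm_unitary_mul hU 1, mul_one]
    _ ≤ n * 1 := by rw [h1]; exact frobenius_norm_rdiag_le fun i => by simp
    _ = n := mul_one _

theorem Filter.Tendsto.matrix_apply {ι : Type*} {l : Filter ι}
    {A : ι → Matrix (Fin n) (Fin n) ℂ} {A' : Matrix (Fin n) (Fin n) ℂ}
    (h : Tendsto A l (𝓝 A')) (i j : Fin n) : Tendsto (fun m => A m i j) l (𝓝 (A' i j)) :=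
  ((continuous_id.matrix_elem i j).tendsto A').comp h

theorem Filter.Tendsto.matrix_conjTranspose {ι : Type*} {l : Filter ι}
    {A : ι → Matrix (Fin n) (Fin n) ℂ} {A' : Matrix (Fin n) (Fin n) ℂ}
    (h : Tendsto A l (𝓝 A')) : Tendsto (fun m => (A m)ᴴ) l (𝓝 A'ᴴ) :=
  ((continuous_id.matrix_conjTranspose).tendsto A').comp h

/-- Along a sequence approaching a normal matrix, the quadratic form cannot stay nonnegative on
normalized skew-Hermitian parts of idempotents. -/
theorem not_commForm_limit_nonneg {φ₁ φ₂ : ℝ → ℝ} {b : ℝ} (hb : 0 < b)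
    (hC : CondC1 φ₁ φ₂ 0 b) {q : Polynomial ℂ}
    {X V U E : ℕ → Matrix (Fin n) (Fin n) ℂ} {α : ℕ → Fin n → ℝ}
    (h : ∀ m, IsSVD (X m) (V m) (U m) (α m)) (hα : ∀ m i, α m i ∈ Icc 0 b)
    (hq : ∀ m, Polynomial.aeval (X m) (q * q - q) = 0) (hskew : ∀ m, (E m)ᴴ = -E m)
    (hoff : ∀ m, E m * Polynomial.aeval (X m) q + (Polynomial.aeval (X m) q)ᴴ * E m = E m)
    (hnorm : ∀ m, ‖E m‖ = 1) {ε : ℕ → ℝ} (hε : Tendsto ε atTop (𝓝 0))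
    (hform : ∀ m, ε m ≤ (commForm φ₁ φ₂ b (X m) (V m) (U m) (α m) (E m)).re)
    {N V' U' E' : Matrix (Fin n) (Fin n) ℂ} {α' : Fin n → ℝ}
    (hX : Tendsto X atTop (𝓝 N)) (hV : Tendsto V atTop (𝓝 V')) (hU : Tendsto U atTop (𝓝 U'))
    (hE : Tendsto E atTop (𝓝 E')) (hα' : Tendsto α atTop (𝓝 α'))
    (hN : Nᴴ * N = N * Nᴴ) : False := by
  have hαi : ∀ i, Tendsto (fun m => α m i) atTop (𝓝 (α' i)) := fun i =>
    ((continuous_apply i).tendsto α').comp hα'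
  have hα0 : ∀ i, α' i ∈ Icc 0 b := fun i =>
    isClosed_Icc.mem_of_tendsto (hαi i) (Eventually.of_forall fun m => hα m i)
  have hcont : Continuous fun β : Fin n → ℝ => rdiag β := by
    refine Continuous.matrix_diagonal (continuous_pi fun i => ?_)
    exact Complex.continuous_ofReal.comp (continuous_apply i)
  have hsvd : IsSVD N V' U' α' :=
    { left := tendsto_nhds_unique (hV.matrix_conjTranspose.mul hV)
        (by simp only [(h _).left]; exact tendsto_const_nhds)
      right := tendsto_nhds_unique (hU.matrix_conjTranspose.mul hU)
        (by simp only [(h _).right]; exact tendsto_const_nhds)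
      nonneg := fun i => (hα0 i).1
      eq := tendsto_nhds_unique hX
        (((hV.mul ((hcont.tendsto α').comp hα')).mul hU.matrix_conjTranspose).congr
          fun m => (h m).eq.symm) }
  set Q := Polynomial.aeval N q with hQdef
  have hQlim : Tendsto (fun m => Polynomial.aeval (X m) q) atTop (𝓝 Q) :=
    ((q.continuous_aeval).tendsto N).comp hX
  have hQQ : Q * Q = Q := by
    have h1 : Polynomial.aeval N (q * q - q) = 0 := by
      refine tendsto_nhds_unique (((q * q - q).continuous_aeval.tendsto N).comp hX) ?_
      simp only [Function.comp_def, hq]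
      exact tendsto_const_nhds
    rwa [map_sub, map_mul, sub_eq_zero] at h1
  have hQH : Qᴴ = Q := isHermitian_of_normal_idempotent hQQ (aeval_normal hN q)
  have hE0 : E'ᴴ = -E' := tendsto_nhds_unique hE.matrix_conjTranspose
    (hE.neg.congr fun m => (hskew m).symm)
  have hEoff : E' * Q + Q * E' = E' := by
    have h1 := (hE.mul hQlim).add (hQlim.matrix_conjTranspose.mul hE)
    rw [hQH] at h1
    exact tendsto_nhds_unique h1 (hE.congr fun m => (hoff m).symm)
  have hE1 : ‖E'‖ = 1 := tendsto_nhds_unique hE.norm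
    (by simp only [hnorm]; exact tendsto_const_nhds)
  have hNU : ∀ a, α' a = 0 → ∀ i, (N * U') i a = 0 := fun a ha i => by
    rw [hsvd.mul_right_basis, mul_rdiag_apply, ha]; simp
  -- The basis `V'` is adapted to `NNᴴ`; normality transfers its kernel vectors to `N`.
  have hNV : ∀ a, α' a = 0 → ∀ i, (N * V') i a = 0 := by
    intro a ha
    refine col_eq_zero_of_gram_eq_zero ?_
    have e : (N * V')ᴴ * (N * V') = rdiag fun i => α' i ^ 2 := by
      have e1 : (N * V')ᴴ * (N * V') = V'ᴴ * (Nᴴ * N) * V' := by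
        rw [conjTranspose_mul]; simp only [mul_assoc]
      have e2 : V'ᴴ * (N * Nᴴ) * V' = (V'ᴴ * N) * (V'ᴴ * N)ᴴ := by
        rw [conjTranspose_mul, conjTranspose_conjTranspose]; simp only [mul_assoc]
      have e3 : rdiag α' * U'ᴴ * (U' * rdiag α') = rdiag α' * (U'ᴴ * U') * rdiag α' := by
        simp only [mul_assoc]
      rw [e1, hN, e2, hsvd.left_basis_mul, conjTranspose_mul, conjTranspose_conjTranspose,
        rdiag_conjTranspose, e3, hsvd.right, mul_one, rdiag_mul_rdiag]
      simp only [sq]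
    rw [e]
    simp [rdiag, ha]
  have hY : Tendsto (fun m => (U m)ᴴ * ((X m)ᴴ * E m - E m * (X m)ᴴ) * V m) atTop
      (𝓝 (U'ᴴ * (Nᴴ * E' - E' * Nᴴ) * V')) :=
    (hU.matrix_conjTranspose.mul ((hX.matrix_conjTranspose.mul hE).sub
      (hE.mul hX.matrix_conjTranspose))).mul hV
  have hFU : Tendsto (fun m => (U m)ᴴ * E m * U m) atTop (𝓝 (U'ᴴ * E' * U')) :=
    (hU.matrix_conjTranspose.mul hE).mul hU
  have hFV : Tendsto (fun m => (V m)ᴴ * E m * V m) atTop (𝓝 (V'ᴴ * E' * V')) :=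
    (hV.matrix_conjTranspose.mul hE).mul hV
  have hlim : Tendsto (fun m => commForm φ₁ φ₂ b (X m) (V m) (U m) (α m) (E m)) atTop
      (𝓝 (commForm φ₁ φ₂ b N V' U' α' E')) := by
    refine Tendsto.sub (tendsto_weightedForm fun a c => ?_) (tendsto_weightedForm fun a c => ?_)
    · refine tendsto_commCoef_mul hb hC.contDiffOn₁ (fun m => hα m a) (fun m => hα m c) (hαi a)
        (hαi c) (((hFU.matrix_apply a c).star).mul (hY.matrix_apply a c)) fun ha hc => ?_
      rw [compression_ker_eq_zero hsvd.right (hNU a ha) (hNU c hc) hQQ hQH hEoff]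
      simp
    · refine tendsto_commCoef_mul hb hC.contDiffOn₂ (fun m => hα m c) (fun m => hα m a) (hαi c)
        (hαi a) (((hFV.matrix_apply a c).star).mul (hY.matrix_apply a c)) fun hc ha => ?_
      rw [compression_ker_eq_zero hsvd.left (hNV a ha) (hNV c hc) hQQ hQH hEoff]
      simp
  have hge : 0 ≤ (commForm φ₁ φ₂ b N V' U' α' E').re :=
    le_of_tendsto_of_tendsto hε ((Complex.continuous_re.tendsto _).comp hlim)
      (Eventually.of_forall hform)
  have hcomm := hsvd.commute_of_commForm_nonneg hC hα0 hN hE0 hge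
  have hQE : Q * E' = E' * Q := aeval_mul_comm_of_comm hcomm q
  -- Commuting and off-diagonal together give `2QE' = E'`. Multiplying by `Q` yields `QE' = 0`,
  -- hence `E' = 0`, against norm one.
  have h2 : Q * E' + Q * E' = E' := by nth_rewrite 1 [hQE]; exact hEoff
  have h3 : Q * E' = 0 := by
    have h4 := congrArg (fun Z => Q * Z) h2
    simp only [mul_add, ← mul_assoc, hQQ] at h4
    exact left_eq_add.1 h4.symm
  rw [h3, add_zero] at h2
  rw [← h2, norm_zero] at hE1
  exact zero_ne_one hE1

/-- When `P` tends to a Hermitian `Q`, this relation becomes `EQ + QE = E`: the limiting direction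
is off-diagonal for `Q`. -/
theorem skewPart_identity {P : Matrix (Fin n) (Fin n) ℂ} (hP : P * P = P) :
    (P - Pᴴ) * P + Pᴴ * (P - Pᴴ) = P - Pᴴ := by
  have hPH : Pᴴ * Pᴴ = Pᴴ := by rw [← conjTranspose_mul, hP]
  rw [sub_mul, mul_sub, hP, hPH]
  abel

theorem aeval_mul_self_of_aeval_eq_zero {N : Matrix (Fin n) (Fin n) ℂ} {q : Polynomial ℂ}
    (hq : Polynomial.aeval N (q * q - q) = 0) :
    Polynomial.aeval N q * Polynomial.aeval N q = Polynomial.aeval N q := by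
  rw [map_sub, map_mul] at hq
  exact sub_eq_zero.1 hq

/-- Along a trajectory, the quadratic form is eventually strictly negative on the skew-Hermitian
part of a spectral idempotent. -/
theorem IsTrajectory.exists_commForm_rate {φ₁ φ₂ : ℝ → ℝ} {b : ℝ}
    {X : ℝ → Matrix (Fin n) (Fin n) ℂ} (hX : IsTrajectory φ₁ φ₂ b X) (hb : 0 < b)
    (hC : CondC1 φ₁ φ₂ 0 b) {q : Polynomial ℂ}
    (hq : Polynomial.aeval (X 0) (q * q - q) = 0) :
    ∃ c, 0 < c ∧ ∃ t₀, 0 ≤ t₀ ∧ ∀ t, t₀ ≤ t →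
      (trace ((Polynomial.aeval (X t) q - (Polynomial.aeval (X t) q)ᴴ)ᴴ *
        (phiMat φ₁ φ₂ (X t) * Polynomial.aeval (X t) q -
          Polynomial.aeval (X t) q * phiMat φ₁ φ₂ (X t)))).re ≤
      -c * ‖Polynomial.aeval (X t) q - (Polynomial.aeval (X t) q)ᴴ‖ ^ 2 := by
  by_contra! hcon
  set P : ℝ → Matrix (Fin n) (Fin n) ℂ := fun t => Polynomial.aeval (X t) q with hPdef
  have hPt : ∀ t, Polynomial.aeval (X t) q = P t := fun _ => rfl
  simp only [hPt] at hcon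
  -- Failure of every rate supplies times `t m ≥ m` at which the rate `1 / (m + 1)` is violated.
  have hstep : ∀ m : ℕ, ∃ t, (m : ℝ) ≤ t ∧ -(1 / ((m : ℝ) + 1)) * ‖P t - (P t)ᴴ‖ ^ 2 <
      (trace ((P t - (P t)ᴴ)ᴴ * (phiMat φ₁ φ₂ (X t) * P t - P t * phiMat φ₁ φ₂ (X t)))).re :=
    fun m => hcon _ (by positivity) m (by positivity)
  choose t htm ht using hstep
  have ht0 : ∀ m, 0 ≤ t m := fun m => le_trans (by positivity) (htm m)
  choose V U α hsvd using fun m => exists_isSVD (X (t m))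
  have hα : ∀ m i, α m i ∈ Icc 0 b := fun m => ((hsvd m).mem_matIcc_iff 0 b).1 (hX.mem _ (ht0 m))
  have hform : ∀ m : ℕ, -(1 / ((m : ℝ) + 1)) * ‖P (t m) - (P (t m))ᴴ‖ ^ 2 <
      (commForm φ₁ φ₂ b (X (t m)) (V m) (U m) (α m) (P (t m) - (P (t m))ᴴ)).re := by
    intro m
    rw [← (hsvd m).trace_commutator_phiMat (aeval_mul_comm_of_comm rfl q).symm]
    exact ht m
  -- At a Hermitian `P` the violated inequality would read `0 < 0`, so normalising is legitimate.
  have hne : ∀ m, 0 < ‖P (t m) - (P (t m))ᴴ‖ := by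
    intro m
    refine norm_pos_iff.2 fun h0 => ?_
    have := ht m
    rw [h0] at this
    simp at this
  set E : ℕ → Matrix (Fin n) (Fin n) ℂ := fun m =>
    ‖P (t m) - (P (t m))ᴴ‖⁻¹ • (P (t m) - (P (t m))ᴴ) with hE
  have hEnorm : ∀ m, ‖E m‖ = 1 := fun m => by
    rw [hE, norm_smul, norm_inv, norm_norm, inv_mul_cancel₀ (hne m).ne']
  have hEform : ∀ m : ℕ, -(1 / ((m : ℝ) + 1)) ≤
      (commForm φ₁ φ₂ b (X (t m)) (V m) (U m) (α m) (E m)).re := by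
    intro m
    rw [hE, commForm_smul, Complex.re_ofReal_mul]
    have h2 := hne m
    have h1 := (mul_le_mul_iff_right₀ (a := (‖P (t m) - (P (t m))ᴴ‖⁻¹) ^ 2) (by positivity)).2
      (hform m).le
    refine le_trans (le_of_eq ?_) h1
    field_simp
  have hbdd : ∀ m, ((X (t m), V m, U m), E m, α m) ∈ Metric.closedBall
      (0 : (Matrix (Fin n) (Fin n) ℂ × Matrix (Fin n) (Fin n) ℂ × Matrix (Fin n) (Fin n) ℂ) ×
        Matrix (Fin n) (Fin n) ℂ × (Fin n → ℝ)) (n * b + n + 1 + b) := by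
    intro m
    have hn : (0 : ℝ) ≤ n := by positivity
    have hnb : (0 : ℝ) ≤ n * b := by positivity
    rw [mem_closedBall_zero_iff]
    simp only [Prod.norm_mk, sup_le_iff]
    refine ⟨⟨(hX.norm_le (ht0 m)).trans (by linarith), (norm_le_of_isometry (hsvd m).left).trans
      (by linarith), (norm_le_of_isometry (hsvd m).right).trans (by linarith)⟩,
      (hEnorm m).le.trans (by linarith), ?_⟩
    refine (pi_norm_le_iff_of_nonneg hb.le).2 (fun i => ?_) |>.trans (by linarith)
    rw [Real.norm_of_nonneg (hα m i).1]
    exact (hα m i).2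
  have : ProperSpace (Matrix (Fin n) (Fin n) ℂ) := FiniteDimensional.proper ℝ _
  obtain ⟨⟨⟨N, V', U'⟩, E', α'⟩, -, ψ, hψ, hlim⟩ :=
    tendsto_subseq_of_bounded Metric.isBounded_closedBall hbdd
  have hX' := (continuous_fst.comp continuous_fst).tendsto _ |>.comp hlim
  have hV' := (continuous_fst.comp (continuous_snd.comp continuous_fst)).tendsto _ |>.comp hlim
  have hU' := (continuous_snd.comp (continuous_snd.comp continuous_fst)).tendsto _ |>.comp hlim
  have hE' := (continuous_fst.comp continuous_snd).tendsto _ |>.comp hlim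
  have hα' := (continuous_snd.comp continuous_snd).tendsto _ |>.comp hlim
  have htop : Tendsto (fun m => t (ψ m)) atTop atTop :=
    (tendsto_atTop_mono htm tendsto_natCast_atTop_atTop).comp hψ.tendsto_atTop
  have hN := (hX.isStarNormal_of_tendsto hb hC.toCondCL htop hX').2.star_comm_self
  have hε : Tendsto (fun m => -(1 / ((ψ m : ℝ) + 1))) atTop (𝓝 0) := by
    have := (tendsto_one_div_add_atTop_nhds_zero_nat (𝕜 := ℝ)).comp hψ.tendsto_atTop
    simpa [Function.comp_def] using this.neg
  have hqt : ∀ m, Polynomial.aeval (X (t m)) (q * q - q) = 0 := fun m =>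
    hX.aeval_eq_zero hb hC.toCondCL hq (ht0 m)
  refine not_commForm_limit_nonneg hb hC (fun m => hsvd (ψ m)) (fun m => hα (ψ m))
    (fun m => hqt (ψ m)) (E := fun m => E (ψ m)) (fun m => ?_) (fun m => ?_)
    (fun m => hEnorm (ψ m)) hε (fun m => hEform (ψ m)) hX' hV' hU' hE' hα' hN
  · simp only [hE, conjTranspose_smul, conjTranspose_sub, conjTranspose_conjTranspose, star_trivial]
    rw [← smul_neg, neg_sub]
  · simp only [hE, smul_mul_assoc, mul_smul_comm, ← smul_add]
    rw [hPt, skewPart_identity (aeval_mul_self_of_aeval_eq_zero (hqt (ψ m)))]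

/-! ### Exponential decay and convergence of the idempotents -/

/-- Pairing with a skew `D` sees `Z` and `-Zᴴ` equally, and the two product-rule terms agree: hence
the 4. -/
theorem two_re_trace_skew {Z D : Matrix (Fin n) (Fin n) ℂ} (hD : Dᴴ = -D) :
    reTrace n ((Z - Zᴴ)ᴴ * D + Dᴴ * (Z - Zᴴ)) = 4 * (trace (Dᴴ * Z)).re := by
  have h1 : (trace (Zᴴ * D)).re = (trace (Dᴴ * Z)).re := by
    rw [← Complex.conj_re, ← Complex.star_def, ← trace_conjTranspose,
      conjTranspose_mul, conjTranspose_conjTranspose]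
  have h2 : (trace (D * Zᴴ)).re = (trace (Z * Dᴴ)).re := by
    rw [← Complex.conj_re, ← Complex.star_def, ← trace_conjTranspose,
      conjTranspose_mul, conjTranspose_conjTranspose]
  have h3 : trace (Z * D) = - trace (Dᴴ * Z) := by
    rw [hD, neg_mul, trace_neg, neg_neg, trace_mul_comm]
  have h4 : trace (Dᴴ * Zᴴ) = -trace (D * Zᴴ) := by rw [hD, neg_mul, trace_neg]
  have h5 : trace (Z * Dᴴ) = trace (Dᴴ * Z) := trace_mul_comm _ _
  rw [reTrace_apply, conjTranspose_sub, conjTranspose_conjTranspose, sub_mul, mul_sub]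
  simp only [trace_add, trace_sub, Complex.add_re, Complex.sub_re, h1, h3, h4, Complex.neg_re, h2,
    h5]
  ring

theorem IsTrajectory.exists_norm_skewPart_le {φ₁ φ₂ : ℝ → ℝ} {b : ℝ}
    {X : ℝ → Matrix (Fin n) (Fin n) ℂ} (hX : IsTrajectory φ₁ φ₂ b X) (hb : 0 < b)
    (hC : CondC1 φ₁ φ₂ 0 b) {q : Polynomial ℂ}
    (hq : Polynomial.aeval (X 0) (q * q - q) = 0) :
    ∃ c, 0 < c ∧ ∃ t₀, 0 ≤ t₀ ∧ ∃ D, 0 ≤ D ∧ ∀ t, t₀ ≤ t →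
      ‖Polynomial.aeval (X t) q - (Polynomial.aeval (X t) q)ᴴ‖ ≤ D * Real.exp (-c * t) := by
  obtain ⟨c, hc, t₀, ht₀, hrate⟩ := hX.exists_commForm_rate hb hC hq
  set P : ℝ → Matrix (Fin n) (Fin n) ℂ := fun t => Polynomial.aeval (X t) q with hPdef
  have hPt : ∀ t, Polynomial.aeval (X t) q = P t := fun _ => rfl
  simp only [hPt] at hrate ⊢
  set W : ℝ → ℝ := fun t => ‖P t - (P t)ᴴ‖ ^ 2 with hW
  have hWd : ∀ t, 0 ≤ t → HasDerivAt W (4 * (trace ((P t - (P t)ᴴ)ᴴ *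
      (phiMat φ₁ φ₂ (X t) * P t - P t * phiMat φ₁ φ₂ (X t)))).re) t := by
    intro t ht
    have h1 : HasDerivAt P _ t := (hX.hasDerivAt t ht).aeval_commutator q
    have h2 := h1.sub h1.matrix_conjTranspose
    have h3 := (reTrace n).hasFDerivAt.comp_hasDerivAt t (h2.matrix_conjTranspose.mul h2)
    rw [← two_re_trace_skew (by
      rw [conjTranspose_sub, conjTranspose_conjTranspose, neg_sub])]
    refine h3.congr_of_eventuallyEq (Eventually.of_forall fun s => ?_)
    exact frobenius_norm_sq_eq_trace _
  -- The rate bound reads `W' ≤ -4cW`; the square root of the resulting estimate decays at rate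
  -- `2c`.
  have hanti : AntitoneOn (fun t => W t * Real.exp (4 * c * t)) (Ici t₀) := by
    have hd : ∀ t, t₀ ≤ t → HasDerivAt (fun t => W t * Real.exp (4 * c * t)) _ t := fun t ht =>
      (hWd t (ht₀.trans ht)).mul (((hasDerivAt_id t).const_mul (4 * c)).exp)
    refine antitoneOn_of_deriv_nonpos (convex_Ici _)
      (fun t ht => (hd t ht).continuousAt.continuousWithinAt)
      (fun t ht => (hd t (interior_subset ht)).differentiableAt.differentiableWithinAt)
      fun t ht => ?_
    rw [(hd t (interior_subset ht)).deriv]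
    have h1 := hrate t (interior_subset ht)
    have h2 := Real.exp_pos (4 * c * t)
    simp only [id, mul_one]
    have h3 : W t = ‖P t - (P t)ᴴ‖ ^ 2 := rfl
    rw [← h3] at h1
    nlinarith
  refine ⟨2 * c, by positivity, t₀, ht₀, ‖P t₀ - (P t₀)ᴴ‖ * Real.exp (2 * c * t₀),
    by positivity, fun t ht => ?_⟩
  have h1 : ‖P t - (P t)ᴴ‖ ^ 2 * Real.exp (4 * c * t) ≤
      ‖P t₀ - (P t₀)ᴴ‖ ^ 2 * Real.exp (4 * c * t₀) := hanti self_mem_Ici ht ht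
  have h2 : ∀ s, Real.exp (4 * c * s) = Real.exp (2 * c * s) ^ 2 := fun s => by
    rw [← Real.exp_nat_mul]; congr 1; push_cast; ring
  rw [h2, h2, ← mul_pow, ← mul_pow] at h1
  have h3 := (sq_le_sq₀ (by positivity) (by positivity)).1 h1
  rw [neg_mul, Real.exp_neg, ← div_eq_mul_inv, le_div_iff₀ (Real.exp_pos _)]
  exact h3

/-- A function whose derivative decays exponentially converges. -/
theorem exists_tendsto_of_norm_deriv_le_exp {F : Type*} [NormedAddCommGroup F] [NormedSpace ℝ F]
    [CompleteSpace F] {f f' : ℝ → F} {D c t₀ : ℝ} (hc : 0 < c)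
    (hf : ∀ t, t₀ ≤ t → HasDerivAt f (f' t) t)
    (hf' : ∀ t, t₀ ≤ t → ‖f' t‖ ≤ D * Real.exp (-c * t)) :
    ∃ L, Tendsto f atTop (𝓝 L) := by
  have hint : IntegrableOn f' (Ioi t₀) := by
    have hB : IntegrableOn (fun t => D * Real.exp (-c * t)) (Ioi t₀) :=
      (integrableOn_exp_mul_Ioi (by linarith) t₀).const_mul D
    refine hB.mono' ?_ ?_
    · refine (aestronglyMeasurable_deriv f _).congr ?_
      filter_upwards [ae_restrict_mem measurableSet_Ioi] with t ht
      exact (hf t (le_of_lt ht)).deriv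
    · filter_upwards [ae_restrict_mem measurableSet_Ioi] with t ht
      exact hf' t (le_of_lt ht)
  exact ⟨_, tendsto_limUnder_of_hasDerivAt_of_integrableOn_Ioi
    (fun t ht => hf t (le_of_lt ht)) hint⟩

/-- The velocity of the idempotent is `[φ(X), P]`, which is bounded by the exponentially small `‖P -
Pᴴ‖`. -/
theorem IsTrajectory.exists_tendsto_aeval {φ₁ φ₂ : ℝ → ℝ} {b : ℝ}
    {X : ℝ → Matrix (Fin n) (Fin n) ℂ} (hX : IsTrajectory φ₁ φ₂ b X) (hb : 0 < b)
    (hC : CondC1 φ₁ φ₂ 0 b) {q : Polynomial ℂ}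
    (hq : Polynomial.aeval (X 0) (q * q - q) = 0) :
    ∃ L, Tendsto (fun t => Polynomial.aeval (X t) q) atTop (𝓝 L) := by
  obtain ⟨c, hc, t₀, ht₀, D, hD, hdecay⟩ := hX.exists_norm_skewPart_le hb hC hq
  obtain ⟨C, hC0, hcomm⟩ := hC.exists_norm_commutator_le (n := n) hb
  refine exists_tendsto_of_norm_deriv_le_exp (D := C * D) hc
    (fun t ht => (hX.hasDerivAt t (ht₀.trans ht)).aeval_commutator q) fun t ht => ?_
  refine (hcomm _ _ (hX.mem t (ht₀.trans ht)) (aeval_mul_comm_of_comm rfl q).symm).trans ?_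
  rw [mul_assoc]
  exact mul_le_mul_of_nonneg_left (hdecay t ht) hC0

/-! ### Reconstruction of the limit from the idempotents -/

/-- Normality passes nilpotency to the Hermitian `H = MᴴM`. The exponent is raised to a power of
two, then halved repeatedly, as `HʲHʲ` is the Gram matrix of `Hʲ`. -/
theorem eq_zero_of_normal_pow_eq_zero {M : Matrix (Fin n) (Fin n) ℂ} (hM : Mᴴ * M = M * Mᴴ)
    {k : ℕ} (hk : M ^ k = 0) : M = 0 := by
  have hcomm : Commute Mᴴ M := hM
  have hH : (Mᴴ * M) ^ (2 ^ k) = 0 := by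
    rw [hcomm.mul_pow]
    have : M ^ (2 ^ k) = 0 := pow_eq_zero_of_le k.lt_two_pow_self.le hk
    rw [this, mul_zero]
  have hdown : ∀ j, (Mᴴ * M) ^ (2 ^ j) = 0 → Mᴴ * M = 0 := by
    intro j
    induction j with
    | zero => intro h; simpa using h
    | succ j ih =>
      intro h
      refine ih (conjTranspose_mul_self_eq_zero.1 ?_)
      rw [conjTranspose_pow, conjTranspose_mul, conjTranspose_conjTranspose, ← pow_add, ← two_mul,
        ← pow_succ', h]
  exact conjTranspose_mul_self_eq_zero.1 (hdown k hH)

open Polynomial in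
/-- The polynomial that yields the spectral idempotent of a root. -/
theorem exists_idempotent_polynomial {χ : ℂ[X]} (hχ : χ ≠ 0) (z : ℂ) :
    ∃ p : ℂ[X], χ ∣ p * p - p ∧ ∀ w, χ.IsRoot w → p.eval w = if w = z then 1 else 0 := by
  obtain ⟨r, hr, hndvd⟩ := exists_eq_pow_rootMultiplicity_mul_and_not_dvd χ hχ z
  set m := χ.rootMultiplicity z with hm
  have hcop : IsCoprime ((X - C z) ^ m) r :=
    IsCoprime.pow_left (((irreducible_X_sub_C z).coprime_iff_not_dvd).2 hndvd)
  obtain ⟨u, v, huv⟩ := hcop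
  -- By Bézout `u (X - z)^m + v r = 1`, so `p = v r` satisfies `p² - p = -u v (X - z)^m r`.
  refine ⟨v * r, ?_, fun w hw => ?_⟩
  · refine ⟨-(u * v), ?_⟩
    rw [hr]
    linear_combination (v * r) * huv
  · have he := congrArg (eval w) huv
    simp only [eval_add, eval_mul, eval_pow, eval_sub, eval_X, eval_C, eval_one] at he
    split_ifs with h
    · subst h
      have hm0 : m ≠ 0 := ((rootMultiplicity_pos hχ).2 hw).ne'
      rw [sub_self, zero_pow hm0, mul_zero, zero_add] at he
      rw [eval_mul, he]
    · have hw' : eval w χ = 0 := hw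
      rw [hr, eval_mul, eval_pow, eval_sub, eval_X, eval_C] at hw'
      have hr0 : eval w r = 0 :=
        (mul_eq_zero.1 hw').resolve_left (pow_ne_zero _ (sub_ne_zero.2 h))
      rw [eval_mul, hr0, mul_zero]

-- Over `ℂ` the polynomial `χ` is a product of `natDegree` linear factors, each of which divides
-- `r`.
open Polynomial in
theorem dvd_pow_natDegree_of_eval_roots {χ r : ℂ[X]} (hχ : χ.Monic)
    (hr : ∀ w, χ.IsRoot w → r.eval w = 0) : χ ∣ r ^ χ.natDegree := by
  have hs := IsAlgClosed.splits χ
  have h1 : χ = (χ.roots.map fun a => X - C a).prod := hs.eq_prod_roots_of_monic hχ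
  have h2 : χ.natDegree = Multiset.card χ.roots := hs.natDegree_eq_card_roots
  have h3 : r ^ χ.natDegree = (χ.roots.map fun _ => r).prod := by
    rw [Multiset.map_const', Multiset.prod_replicate, h2]
  rw [h3]
  nth_rewrite 1 [h1]
  refine Multiset.prod_dvd_prod_of_dvd _ _ fun a ha => dvd_iff_isRoot.2 ?_
  exact hr a (isRoot_of_mem_roots ha)

/-- Every trajectory converges to a normal matrix. The spectral idempotents of `X t` become
Hermitian exponentially fast, hence converge, and they determine the limit; condition `(C1)` alone
is enough for this, no holomorphic extension of `φ₁, φ₂` is needed. -/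
theorem IsTrajectory.exists_tendsto_isStarNormal {φ₁ φ₂ : ℝ → ℝ} {b : ℝ}
    {X : ℝ → Matrix (Fin n) (Fin n) ℂ} (hX : IsTrajectory φ₁ φ₂ b X) (hb : 0 < b)
    (hC : CondC1 φ₁ φ₂ 0 b) :
    ∃ N : Matrix (Fin n) (Fin n) ℂ, IsStarNormal N ∧ Tendsto X atTop (𝓝 N) := by
  set χ := (X 0).charpoly with hχdef
  have hmonic : χ.Monic := charpoly_monic _
  choose p hpdvd hpeval using exists_idempotent_polynomial hmonic.ne_zero
  have hann : ∀ q, χ ∣ q → Polynomial.aeval (X 0) q = 0 := by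
    rintro q ⟨s, rfl⟩
    rw [map_mul, hχdef, aeval_self_charpoly, zero_mul]
  choose L hL using fun z => hX.exists_tendsto_aeval hb hC (hann _ (hpdvd z))
  -- The polynomial `g` takes the value `w` at every root `w` of `χ`, so `X - g(X)` is nilpotent
  -- along the trajectory, while `g(X)` converges with the idempotents.
  set g : Polynomial ℂ := ∑ z ∈ χ.roots.toFinset, Polynomial.C z * p z with hg
  have hroot : ∀ w, χ.IsRoot w → (Polynomial.X - g).eval w = 0 := by
    intro w hw
    have hmem : w ∈ χ.roots.toFinset :=
      Multiset.mem_toFinset.2 ((Polynomial.mem_roots hmonic.ne_zero).2 hw)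
    simp only [hg, Polynomial.eval_sub, Polynomial.eval_X, Polynomial.eval_finsetSum,
      Polynomial.eval_mul, Polynomial.eval_C, hpeval _ w hw, mul_ite, mul_one, mul_zero]
    rw [Finset.sum_ite_eq, if_pos hmem, sub_self]
  have hdvd := dvd_pow_natDegree_of_eval_roots hmonic hroot
  have hnil : ∀ t, 0 ≤ t → Polynomial.aeval (X t) ((Polynomial.X - g) ^ χ.natDegree) = 0 :=
    fun t ht => hX.aeval_eq_zero hb hC.toCondCL (hann _ hdvd) ht
  have hglim : Tendsto (fun t => Polynomial.aeval (X t) g) atTop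
      (𝓝 (∑ z ∈ χ.roots.toFinset, z • L z)) := by
    simp only [hg, map_sum, map_mul, Polynomial.aeval_C, ← Algebra.smul_def]
    exact tendsto_finsetSum _ fun z _ => (hL z).const_smul z
  have hcont : ∀ q : Polynomial ℂ, Continuous fun M : Matrix (Fin n) (Fin n) ℂ =>
      Polynomial.aeval M q := fun q => by fun_prop
  have hlimit : ∀ {t : ℕ → ℝ}, Tendsto t atTop atTop → ∀ {N : Matrix (Fin n) (Fin n) ℂ},
      Tendsto (fun m => X (t m)) atTop (𝓝 N) → N = ∑ z ∈ χ.roots.toFinset, z • L z := by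
    intro t ht N hN
    have hnormal := (hX.isStarNormal_of_tendsto hb hC.toCondCL ht hN).2.star_comm_self
    have h0 : Polynomial.aeval N ((Polynomial.X - g) ^ χ.natDegree) = 0 := by
      refine tendsto_nhds_unique (((hcont _).tendsto N).comp hN)
        (tendsto_const_nhds.congr' ?_)
      filter_upwards [ht.eventually_ge_atTop 0] with m hm
      exact (hnil _ hm).symm
    rw [map_pow] at h0
    have h1 := eq_zero_of_normal_pow_eq_zero (aeval_normal hnormal _) h0
    rw [map_sub, Polynomial.aeval_X, sub_eq_zero] at h1
    rw [h1]
    exact tendsto_nhds_unique (((hcont g).tendsto N).comp hN) (hglim.comp ht)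
  have : ProperSpace (Matrix (Fin n) (Fin n) ℂ) := FiniteDimensional.proper ℝ _
  have htend : Tendsto X atTop (𝓝 (∑ z ∈ χ.roots.toFinset, z • L z)) := by
    -- The trajectory is bounded and all its limit points coincide, which gives convergence.
    refine tendsto_of_subseq_tendsto fun t ht => ?_
    obtain ⟨M, -, ψ, hψ, hM⟩ := tendsto_subseq_of_frequently_bounded
      (Metric.isBounded_closedBall (x := (0 : Matrix (Fin n) (Fin n) ℂ)) (r := n * b))
      (x := fun m => X (t m)) (Eventually.frequently <| by
        filter_upwards [ht.eventually_ge_atTop 0] with m hm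
        exact mem_closedBall_zero_iff.2 (hX.norm_le hm))
    have hM' := hlimit (ht.comp hψ.tendsto_atTop) hM
    exact ⟨ψ, hM' ▸ hM⟩
  exact ⟨_, (hX.isStarNormal_of_tendsto hb hC.toCondCL tendsto_natCast_atTop_atTop
    (htend.comp tendsto_natCast_atTop_atTop)).2, htend⟩

theorem IsTrajectory.isGlobalSolution {φ₁ φ₂ : ℝ → ℝ} {b : ℝ}
    {X : ℝ → Matrix (Fin n) (Fin n) ℂ} (hX : IsTrajectory φ₁ φ₂ b X) :
    IsGlobalSolution φ₁ φ₂ 0 b (X 0) X where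
  init := rfl
  mem := hX.mem
  ode t ht := by exact (hX.hasDerivAt t ht).hasDerivWithinAt

end SpectralFlow

theorem mainTheorem3 (n : ℕ) (b ε : ℝ) (hb : 0 < b) (hε : 0 < ε)
    (φ₁ φ₂ : ℝ → ℝ) (hC1 : CondC1 φ₁ φ₂ 0 b) (hφ₁ : φ₁ 0 = 0) (hφ₂ : φ₂ 0 = 0)
    (ψ₁ ψ₂ : ℂ → ℂ) (hψ₁ : IsHolomorphicExtension φ₁ b ε ψ₁)
    (hψ₂ : IsHolomorphicExtension φ₂ b ε ψ₂)
    (hint :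
      (IntegrableOn (fun t : ℝ => ‖ψ₁ (Complex.I * t)‖ / t ^ 2) (Icc (-ε) ε) ∧
        IntegrableOn (fun t : ℝ => ‖ψ₂ (Complex.I * t)‖ / t ^ 2) (Icc (-ε) ε)) ∨
      ((∀ x ∈ Icc 0 b, φ₂ x = 0) ∧
        (∃ C : ℝ, ∀ x ∈ Ioc 0 b, |derivWithin φ₁ (Icc 0 b) x / x| ≤ C) ∧
        IntegrableOn (fun t : ℝ => ‖ψ₁ (Complex.I * t)‖ / |t|) (Icc (-ε) ε)))
    (T : Matrix (Fin n) (Fin n) ℂ) (hT : T ∈ matIcc n 0 b) :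
    ∃ X : ℝ → Matrix (Fin n) (Fin n) ℂ,
      IsGlobalSolution φ₁ φ₂ 0 b T X ∧
      (∀ X' : ℝ → Matrix (Fin n) (Fin n) ℂ,
        IsGlobalSolution φ₁ φ₂ 0 b T X' → ∀ t, 0 ≤ t → X' t = X t) ∧
      ∃ N : Matrix (Fin n) (Fin n) ℂ, IsStarNormal N ∧ Tendsto X atTop (𝓝 N) := by
  obtain ⟨X, rfl, hmem, hder, huniq⟩ := hC1.toCondCL.exists_unique_flow hb hT
  have hX : IsTrajectory φ₁ φ₂ b X := ⟨hmem, hder⟩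
  exact ⟨X, hX.isGlobalSolution, huniq, hX.exists_tendsto_isStarNormal hb hC1⟩
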